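/- **Theorem 2.8 (Characterization of Hilbert functions).** Let $(R_0,\mathfrak m)$ be an Artinian local equicharacteristic ring, that is, $R_0$ and its residue field have the same characteristic; let $H:\mathbb N\to\mathbb N$ be a function, $b\ge 1$, and $R=R_0[X_1,\dots,X_b]$, graded by total degree, with $R_+=\bigoplus_{n\ge1}R_n$. Write $\lambda$ for length over $R_0$. For a homogeneous ideal $I\subseteq R_+$ let $H_{R/I}(n)=\lambda((R/I)_n)$. For integers $m,d\ge 1$ let $m=\binom{k_d}{d}+\dots+\binom{k_\delta}{\delta}$, with $k_d>\dots>k_\delta\ge\delta\ge1$, be the unique $d$-binomial expansion of $m$, and put $$(m_d)^+_+=\binom{k_d+1}{d+1}+\dots+\binom{k_\delta+1}{\delta+1};$$ put $(0_d)^+_+=0$ for all $d\ge 0$. For all $n\ge 0$ let $$H(n)=\binom{n+b-1}{b-1}q(n)+r(n),\qquad 0\le r(n)<\binom{n+b-1}{b-1},$$ be the Euclidean division (so $r(0)=0$). Then the following conditions are equivalent: 1. there exists a homogeneous ideal $I\subseteq R_+$ such that $H=H_{R/I}$; 2. $H(0)=\lambda(R_0)$ and $H(n+1)\le\binom{n+b}{b-1}q(n)+(r(n)_n)^+_+$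 for all $n\ge0$. Moreover, if condition 2 holds and $\mathcal J=\{0=J_0\subset J_1\subset\dots\subset J_s=R_0\}$ is any composition series of $R_0$ (so $s=\lambda(R_0)$), then there is a unique $\mathcal J$-segment ideal $I$ of $R$ with $H_{R/I}=H$. Here, for $n\ge1$, the submodules $J_iX^u$ of $R_n$ ($1\le i\le s$, $|u|=n$) are ordered by: $J_iX^u<J_lX^v$ if $i<l$, or if $i=l$ and the last nonzero entry of $v-u$ is negative; and a homogeneous ideal $I\subseteq R_+$ is a $\mathcal J$-segment ideal if for every $n\ge 1$ the component $I_n$ is generated as an $R_0$-module by the $s\binom{n+b-1}{b-1}-\lambda(R_n/I_n)$ smallest of these submodules. -/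

import Mathlib

open MvPolynomial

namespace ArtinianHilbert

/-! ### Binomial expansions -/

/-- `n = C(k_d, d) + C(k_{d-1}, d-1) + ⋯ + C(k_δ, δ)` with `k_d > k_{d-1} > ⋯ > k_δ ≥ δ ≥ 1`
is the `d`-binomial expansion of `n`. Only the values `k i` for `δ ≤ i ≤ d` are relevant. -/
structure IsBinomialExpansion (d n δ : ℕ) (k : ℕ → ℕ) : Prop where
  one_le : 1 ≤ δ
  le_d : δ ≤ d
  le_k : δ ≤ k δ
  lt_succ : ∀ i, δ ≤ i → i < d → k i < k (i + 1)
  sum_eq : n = ∑ i ∈ Finset.Icc δ d, (k i).choose i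

open Classical in
/-- The number `(n_d)^+_+ = C(k_d + 1, d + 1) + ⋯ + C(k_δ + 1, δ + 1)`, computed from the
`d`-binomial expansion of `n`, which exists and is unique when `n, d ≥ 1` (see
`exists_isBinomialExpansion` and `IsBinomialExpansion.unique`).
If there is no expansion (that is, if `n = 0` or `d = 0`) the value is `0`. -/
noncomputable def plusPlus (d n : ℕ) : ℕ :=
  if h : ∃ p : ℕ × (ℕ → ℕ), IsBinomialExpansion d n p.1 p.2 then
    ∑ i ∈ Finset.Icc h.choose.1 d, (h.choose.2 i + 1).choose (i + 1)
  else 0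

theorem IsBinomialExpansion.pred {d n δ : ℕ} {k : ℕ → ℕ}
    (h : IsBinomialExpansion (d + 1) n δ k) (hδ : δ ≤ d) :
    IsBinomialExpansion d (∑ i ∈ Finset.Icc δ d, (k i).choose i) δ k ∧
      n = (∑ i ∈ Finset.Icc δ d, (k i).choose i) + (k (d + 1)).choose (d + 1) := by
  refine ⟨⟨h.one_le, hδ, h.le_k, fun i h1 h2 => h.lt_succ i h1 (by omega), rfl⟩, ?_⟩
  rw [h.sum_eq, Finset.sum_Icc_succ_top (by omega)]

theorem IsBinomialExpansion.bounds {d : ℕ} : ∀ {n δ : ℕ} {k : ℕ → ℕ},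
    IsBinomialExpansion d n δ k →
      d ≤ k d ∧ (k d).choose d ≤ n ∧ n < (k d + 1).choose d := by
  induction d with
  | zero => intro n δ k h; have := h.one_le; have := h.le_d; omega
  | succ d ih =>
    intro n δ k h
    rcases Nat.lt_or_ge d δ with hd | hd
    · have e : δ = d + 1 := by have := h.le_d; omega
      subst e
      have hk := h.le_k
      have hn := h.sum_eq
      simp only [Finset.Icc_self, Finset.sum_singleton] at hn
      refine ⟨hk, hn.ge, ?_⟩
      rw [Nat.choose_succ_succ', hn]
      have := Nat.choose_pos (n := k (d + 1)) (k := d) (by omega)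
      omega
    · obtain ⟨h1, h2⟩ := h.pred hd
      obtain ⟨h3, h4, h5⟩ := ih h1
      have h6 := h.lt_succ d hd (by omega)
      have h7 := Nat.choose_le_choose d (show k d + 1 ≤ k (d + 1) by omega)
      rw [Nat.choose_succ_succ']
      omega

theorem IsBinomialExpansion.pos {d n δ : ℕ} {k : ℕ → ℕ} (h : IsBinomialExpansion d n δ k) :
    1 ≤ d ∧ 1 ≤ n := by
  obtain ⟨h1, h2, -⟩ := h.bounds
  have := Nat.choose_pos h1
  have := h.one_le
  have := h.le_d
  omega

theorem IsBinomialExpansion.unique {d : ℕ} : ∀ {n δ δ' : ℕ} {k k' : ℕ → ℕ},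
    IsBinomialExpansion d n δ k → IsBinomialExpansion d n δ' k' →
      δ = δ' ∧ ∀ i ∈ Finset.Icc δ d, k i = k' i := by
  induction d with
  | zero => intro n δ δ' k k' h; have := h.pos; omega
  | succ d ih =>
    intro n δ δ' k k' h h'
    have top : k (d + 1) = k' (d + 1) := by
      obtain ⟨-, a, b⟩ := h.bounds
      obtain ⟨-, a', b'⟩ := h'.bounds
      by_contra hne
      rcases Nat.lt_or_gt_of_ne hne with hlt | hlt
      · have := Nat.choose_le_choose (d + 1) (show k (d + 1) + 1 ≤ k' (d + 1) by omega)
        omega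
      · have := Nat.choose_le_choose (d + 1) (show k' (d + 1) + 1 ≤ k (d + 1) by omega)
        omega
    have l := h.le_d
    have l' := h'.le_d
    rcases Nat.lt_or_ge d δ with hd | hd <;> rcases Nat.lt_or_ge d δ' with hd' | hd'
    · refine ⟨by omega, fun i hi => ?_⟩
      rw [Finset.mem_Icc] at hi
      have : i = d + 1 := by omega
      rw [this, top]
    · have e : δ = d + 1 := by omega
      have hn := h.sum_eq
      rw [e] at hn
      simp only [Finset.Icc_self, Finset.sum_singleton] at hn
      obtain ⟨p, s⟩ := h'.pred hd'
      have := p.pos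
      rw [← top] at s
      omega
    · have e : δ' = d + 1 := by omega
      have hn := h'.sum_eq
      rw [e] at hn
      simp only [Finset.Icc_self, Finset.sum_singleton] at hn
      obtain ⟨p, s⟩ := h.pred hd
      have := p.pos
      rw [top] at s
      omega
    · obtain ⟨p, s⟩ := h.pred hd
      obtain ⟨p', s'⟩ := h'.pred hd'
      rw [top] at s
      have e : ∑ i ∈ Finset.Icc δ d, (k i).choose i = ∑ i ∈ Finset.Icc δ' d, (k' i).choose i := by
        omega
      rw [← e] at p'
      obtain ⟨u, v⟩ := ih p p'
      refine ⟨u, fun i hi => ?_⟩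
      rw [Finset.mem_Icc] at hi
      rcases Nat.lt_or_ge d i with hi' | hi'
      · have : i = d + 1 := by omega
        rw [this, top]
      · exact v i (Finset.mem_Icc.2 ⟨hi.1, hi'⟩)

theorem exists_isBinomialExpansion {d : ℕ} (hd : 1 ≤ d) : ∀ {n : ℕ}, 1 ≤ n →
    ∃ δ k, IsBinomialExpansion d n δ k := by
  induction d, hd using Nat.le_induction with
  | base =>
    intro n hn
    exact ⟨1, fun _ => n, le_rfl, le_rfl, hn, fun i _ _ => by omega, by simp⟩
  | succ d hd ih =>
    intro n hn
    have large : n < (n + d + 1).choose (d + 1) := by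
      clear ih hn
      induction n with
      | zero => simp
      | succ n ihn =>
        have e : n + 1 + d + 1 = (n + d + 1) + 1 := by omega
        rw [e, Nat.choose_succ_succ']
        have := Nat.choose_pos (n := n + d + 1) (k := d) (by omega)
        omega
    have ex : ∃ m, n < (m + 1).choose (d + 1) := ⟨n + d, large⟩
    classical
    obtain ⟨m, hm, hmin⟩ : ∃ m, n < (m + 1).choose (d + 1) ∧ m.choose (d + 1) ≤ n := by
      refine ⟨Nat.find ex, Nat.find_spec ex, ?_⟩
      rcases h0 : Nat.find ex with _ | j
      · simp
      · have := Nat.find_min ex (show j < Nat.find ex by omega)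
        omega
    have hmd : d + 1 ≤ m := by
      by_contra hlt
      have := Nat.choose_le_choose (d + 1) (show m + 1 ≤ d + 1 by omega)
      rw [Nat.choose_self] at this
      omega
    rcases Nat.eq_or_lt_of_le hmin with heq | hlt
    · exact ⟨d + 1, fun _ => m, by omega, le_rfl, hmd, fun i _ _ => by omega, by simp [heq]⟩
    · obtain ⟨δ, k, h⟩ := ih (n := n - m.choose (d + 1)) (by omega)
      have hk : k d < m := by
        by_contra hge
        have h1 := Nat.choose_le_choose d (show m ≤ k d by omega)
        have h2 := h.bounds.2.1
        rw [Nat.choose_succ_succ'] at hm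
        omega
      have hδ := h.le_d
      refine ⟨δ, Function.update k (d + 1) m, h.one_le, by omega, ?_, ?_, ?_⟩
      · rw [Function.update_of_ne (by omega)]
        exact h.le_k
      · intro i hi1 hi2
        rw [Function.update_of_ne (by omega)]
        rcases Nat.lt_or_ge i d with hid | hid
        · rw [Function.update_of_ne (by omega)]
          exact h.lt_succ i hi1 hid
        · have : i = d := by omega
          subst this
          simpa using hk
      · rw [Finset.sum_Icc_succ_top (by omega), Function.update_self]
        have : ∑ i ∈ Finset.Icc δ d, (Function.update k (d + 1) m i).choose i
            = ∑ i ∈ Finset.Icc δ d, (k i).choose i := by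
          refine Finset.sum_congr rfl fun i hi => ?_
          rw [Finset.mem_Icc] at hi
          rw [Function.update_of_ne (by omega)]
        rw [this, ← h.sum_eq]
        omega

/-- `plusPlus` may be computed from any binomial expansion. -/
theorem IsBinomialExpansion.plusPlus_eq {d n δ : ℕ} {k : ℕ → ℕ}
    (h : IsBinomialExpansion d n δ k) :
    plusPlus d n = ∑ i ∈ Finset.Icc δ d, (k i + 1).choose (i + 1) := by
  have ex : ∃ p : ℕ × (ℕ → ℕ), IsBinomialExpansion d n p.1 p.2 := ⟨(δ, k), h⟩
  rw [plusPlus, dif_pos ex]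
  obtain ⟨h1, h2⟩ := ex.choose_spec.unique h
  rw [← h1]
  exact Finset.sum_congr rfl fun i hi => by rw [h2 i hi]

theorem plusPlus_zero (d : ℕ) : plusPlus d 0 = 0 := by
  rw [plusPlus, dif_neg]
  rintro ⟨p, hp⟩
  have := hp.pos
  omega

/-! ### Hilbert functions of `R₀[X_1, …, X_b] / I` -/

/-- `R₀` is equicharacteristic: it has the same characteristic as its residue field. -/
def IsEquicharacteristic (R₀ : Type*) [CommRing R₀] [IsLocalRing R₀] : Prop :=
  ringChar R₀ = ringChar (IsLocalRing.ResidueField R₀)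

attribute [local instance] MvPolynomial.gradedAlgebra

/-- `I` is a homogeneous ideal of `R = R₀[X_1, …, X_b]` (with its grading by the total degree)
contained in the irrelevant ideal `R_+ = ⨁_{n ≥ 1} R_n`. -/
def IsHomogeneousInIrrelevant {R₀ : Type*} [CommRing R₀] {b : ℕ}
    (I : Ideal (MvPolynomial (Fin b) R₀)) : Prop :=
  I.IsHomogeneous (homogeneousSubmodule (Fin b) R₀) ∧
    I ≤ (HomogeneousIdeal.irrelevant (homogeneousSubmodule (Fin b) R₀)).toIdeal

/-- The Hilbert function `H_S(n) = λ_{R₀}(S_n)` of `S = R / I`, where `R = R₀[X_1, …, X_b]` and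
`S_n` is the image of `R_n` in `S`. -/
noncomputable def hilbertFunction {R₀ : Type*} [CommRing R₀] {b : ℕ}
    (I : Ideal (MvPolynomial (Fin b) R₀)) (n : ℕ) : ℕ∞ :=
  Module.length R₀
    ((homogeneousSubmodule (Fin b) R₀ n).map (Ideal.Quotient.mkₐ R₀ I).toLinearMap)

/-- The homogeneous component `I_n = I ∩ R_n`, as an `R₀`-submodule of `R`. -/
noncomputable def gradedPart {R₀ : Type*} [CommRing R₀] {b : ℕ}
    (I : Ideal (MvPolynomial (Fin b) R₀)) (n : ℕ) : Submodule R₀ (MvPolynomial (Fin b) R₀) :=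
  Submodule.restrictScalars R₀ I ⊓ homogeneousSubmodule (Fin b) R₀ n

/-! ### Segment ideals -/

/-- The degree reverse lexicographical order on exponents: `X^u < X^v` if `|u| < |v|`, or if
`|u| = |v|` and the last nonzero entry of `v - u` is negative. -/
def DegRevLexLT {b : ℕ} (u v : Fin b →₀ ℕ) : Prop :=
  u.degree < v.degree ∨
    (u.degree = v.degree ∧ ∃ i, v i < u i ∧ ∀ j, i < j → v j = u j)

/-- The order on pairs `(i, u)` which represents the order on the submodules `J_i X^u`: compare
the indices `i` first, and then the monomials in the degree reverse lexicographical order. -/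
def SegmentLT {b : ℕ} (p p' : ℕ × (Fin b →₀ ℕ)) : Prop :=
  p.1 < p'.1 ∨ (p.1 = p'.1 ∧ DegRevLexLT p.2 p'.2)

/-- The pairs `(i, u)` with `1 ≤ i ≤ s` and `|u| = n`, which index the set `M_n(J)` of the
submodules `J_i X^u` of `R_n`, for a composition series `J` of length `s`. -/
def segmentIndex (b s n : ℕ) : Set (ℕ × (Fin b →₀ ℕ)) :=
  {p | 1 ≤ p.1 ∧ p.1 ≤ s ∧ p.2.degree = n}

/-- The (indices of the) `m` smallest elements of `M_n(J)`: those with fewer than `m` elements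
of `M_n(J)` below them. -/
def smallestIndices (b s n m : ℕ) : Set (ℕ × (Fin b →₀ ℕ)) :=
  {p ∈ segmentIndex b s n | {p' ∈ segmentIndex b s n | SegmentLT p' p}.ncard < m}

/-- The `i`-th term `J_i` of a series of ideals `0 = J_0 ⊂ J_1 ⊂ ⋯ ⊂ J_s = R₀`
(only used for `i ≤ s`). -/
def seriesTerm {R₀ : Type*} [CommRing R₀] (J : CompositionSeries (Submodule R₀ R₀)) (i : ℕ) :
    Submodule R₀ R₀ :=
  J (Fin.ofNat (J.length + 1) i)

/-- The `R₀`-submodule of `R_n` generated by the `m` smallest elements of `M_n(J)`; here `J_i X^u`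
is the image of `J_i` under `a ↦ a X^u`. -/
noncomputable def segmentPart {R₀ : Type*} [CommRing R₀] (b : ℕ)
    (J : CompositionSeries (Submodule R₀ R₀)) (n m : ℕ) :
    Submodule R₀ (MvPolynomial (Fin b) R₀) :=
  ⨆ p ∈ smallestIndices b J.length n m, (seriesTerm J p.1).map (monomial (R := R₀) p.2)

/-- `I` is a `J`-segment ideal, for a composition series `J` of `R₀` of length `s`: it is
homogeneous, contained in `R_+`, and for all `n ≥ 1` its component `I_n` is generated as an
`R₀`-module by the `s C(n+b-1, b-1) - λ(R_n / I_n)` smallest elements of `M_n(J)`. -/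
def IsSegmentIdeal {R₀ : Type*} [CommRing R₀] {b : ℕ} (J : CompositionSeries (Submodule R₀ R₀))
    (I : Ideal (MvPolynomial (Fin b) R₀)) : Prop :=
  IsHomogeneousInIrrelevant I ∧
    ∀ n, 1 ≤ n → ∃ m : ℕ,
      (m : ℕ∞) + hilbertFunction I n = (J.length * (n + b - 1).choose (b - 1) : ℕ) ∧
      gradedPart I n = segmentPart b J n m

/-- The numerical condition on `H`, where `H(n) = C(n+b-1, b-1) q(n) + r(n)` is the Euclidean
division: `H(0) = λ(R₀)` and `H(n+1) ≤ C(n+b, b-1) q(n) + (r(n)_n)^+_+` for all `n ≥ 0`. -/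
def NumericalCondition (R₀ : Type*) [CommRing R₀] (b : ℕ) (H q r : ℕ → ℕ) : Prop :=
  (H 0 : ℕ∞) = Module.length R₀ R₀ ∧
    ∀ n, H (n + 1) ≤ (n + b).choose (b - 1) * q n + plusPlus n (r n)

end ArtinianHilbert

namespace ArtinianHilbert

attribute [local instance] MvPolynomial.gradedAlgebra

/-! ### The function `plusPlus` -/

/-! Write F_n for `plusPlus n`, N_n for the number of monomials of degree n and s for λ(R₀).

Necessity. For each exponent u, let L_u be the ideal of coefficients at X^u of the forms in I whose
coefficients at all lex-smaller monomials vanish. Then λ(I_n) is the sum of the lengths g(u) of the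
L_u with |u| = n, and L_u ⊆ L_{u+e_j} because X_j shifts the lex order. Hence H(n) is the sum over i
< s of the cardinalities of the sets B_i(n) = {u : |u| = n, g(u) ≤ i}. Each B_i is closed under
divisors, so Macaulay's theorem for monomials (`card_le_plusPlus`) gives |B_i(n+1)| ≤ F_n(|B_i(n)|).
What remains is arithmetic: for numbers in [0, N_n] with sum N_n q + r, the sum of their F_n is
largest for q copies of N_n and one r (`sum_plusPlus_le`), and F_n(N_n) = N_{n+1}.

Both Macaulay's bound and this maximality rest on the inequalities `IsCyclicSuperadditive`, proved
by induction from the recursion `plusPlus_succ_choose_add`.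

Sufficiency. Prescribe the coefficients: at X^u allow J_{s-q} if at least r monomials of the same
degree are larger than X^u, and J_{s-q-1} otherwise. These polynomials form an ideal because
multiplication by the first variable changes the number of larger monomials exactly by F_n
(`rank_add_single_bot`), other variables give at least as many, and the numerical condition compares
r(n+1) with F_n(r(n)) whenever q does not drop. The components of this ideal are the required
segments, and H fixes the size of each segment, whence uniqueness. -/

theorem plusPlus_choose {n : ℕ} (hn : 1 ≤ n) (k : ℕ) :
    plusPlus n (k.choose n) = (k + 1).choose (n + 1) := by
  rcases Nat.lt_or_ge k n with h | h
  · rw [Nat.choose_eq_zero_of_lt h, plusPlus_zero, Nat.choose_eq_zero_of_lt (by omega)]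
  · have e : IsBinomialExpansion n (k.choose n) n (fun _ => k) :=
      ⟨hn, le_rfl, h, fun i _ _ => by omega, by simp⟩
    rw [e.plusPlus_eq]
    simp

theorem plusPlus_one_left (a : ℕ) : plusPlus 1 a = (a + 1).choose 2 := by
  simpa using plusPlus_choose le_rfl a

theorem plusPlus_one_right {n : ℕ} (hn : 1 ≤ n) : plusPlus n 1 = 1 := by
  simpa using plusPlus_choose hn n

theorem plusPlus_one_succ (a : ℕ) : plusPlus 1 (a + 1) = plusPlus 1 a + (a + 1) := by
  rw [plusPlus_one_left, plusPlus_one_left, Nat.choose_succ_succ' (a + 1) 1, Nat.choose_one_right,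
    add_comm]

theorem two_mul_plusPlus_one (a : ℕ) : 2 * plusPlus 1 a = a * (a + 1) := by
  induction a with
  | zero => simp [plusPlus_zero]
  | succ a ih => rw [plusPlus_one_succ, mul_add, ih]; ring

/-- If 0 < v < C(k,n), the expansion of v has top entry below k, so C(k,n+1) can be put in front of
it; the case v = C(k,n) is Pascal's rule. Thus on the block starting at C(k,n+1) the function of
degree n+1 is a translate of the one of degree n, which drives all the inductions below. -/
theorem plusPlus_succ_choose_add {n : ℕ} (hn : 1 ≤ n) {k v : ℕ} (hv : v ≤ k.choose n) :
    plusPlus (n + 1) (k.choose (n + 1) + v) = (k + 1).choose (n + 2) + plusPlus n v := by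
  rcases Nat.eq_or_lt_of_le hv with rfl | hlt
  · rw [add_comm (k.choose (n + 1)), ← Nat.choose_succ_succ', plusPlus_choose (by omega),
      plusPlus_choose hn, Nat.choose_succ_succ' (k + 1), add_comm]
  rcases Nat.eq_zero_or_pos v with rfl | hv0
  · rw [add_zero, plusPlus_choose (by omega), plusPlus_zero, add_zero]
  obtain ⟨δ, κ, h⟩ := exists_isBinomialExpansion hn hv0
  have hk : κ n < k := by
    by_contra hge
    have h1 := Nat.choose_le_choose n (show k ≤ κ n by omega)
    have h2 := h.bounds.2.1
    omega
  have hnk := h.bounds.1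
  have hδ := h.le_d
  have upd (g : ℕ → ℕ → ℕ) : ∑ i ∈ Finset.Icc δ n, g (Function.update κ (n + 1) k i) i
      = ∑ i ∈ Finset.Icc δ n, g (κ i) i := by
    refine Finset.sum_congr rfl fun i hi => ?_
    rw [Finset.mem_Icc] at hi
    rw [Function.update_of_ne (by omega)]
  have e : IsBinomialExpansion (n + 1) (k.choose (n + 1) + v) δ (Function.update κ (n + 1) k) := by
    refine ⟨h.one_le, by omega, ?_, ?_, ?_⟩
    · rw [Function.update_of_ne (by omega)]
      exact h.le_k
    · intro i hi1 hi2
      rw [Function.update_of_ne (by omega)]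
      rcases Nat.lt_or_ge i n with hid | hid
      · rw [Function.update_of_ne (by omega)]
        exact h.lt_succ i hi1 hid
      · have : i = n := by omega
        subst this
        simpa using hk
    · rw [Finset.sum_Icc_succ_top (by omega), Function.update_self, upd fun a i => a.choose i,
        ← h.sum_eq, add_comm]
  rw [e.plusPlus_eq, h.plusPlus_eq, Finset.sum_Icc_succ_top (by omega), Function.update_self,
    upd fun a i => (a + 1).choose (i + 1), add_comm]

/-! ### Rearrangement inequalities for the increments of `plusPlus` -/

theorem exists_choose_le_lt {n : ℕ} (hn : 1 ≤ n) (x : ℕ) :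
    ∃ k, k.choose n ≤ x ∧ x < (k + 1).choose n := by
  induction x with
  | zero => exact ⟨n - 1, by rw [Nat.choose_eq_zero_of_lt (by omega)],
      by rw [show n - 1 + 1 = n by omega]; simp⟩
  | succ x ih =>
    obtain ⟨k, h1, h2⟩ := ih
    rcases Nat.lt_or_ge (x + 1) ((k + 1).choose n) with h | h
    · exact ⟨k, by omega, h⟩
    · refine ⟨k + 1, h, ?_⟩
      obtain ⟨m, rfl⟩ : ∃ m, n = m + 1 := ⟨n - 1, by omega⟩
      have hk : m ≤ k := by
        by_contra hlt
        rw [Nat.choose_eq_zero_of_lt (show k + 1 < m + 1 by omega)] at h2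
        omega
      rw [Nat.choose_succ_succ' (k + 1) m]
      have := Nat.choose_pos (n := k + 1) (k := m) (by omega)
      omega

/-- The `q` last increments of `plusPlus n` on `[0, C(k, n)]` dominate all others, and the first
ones are dominated by all others. -/
structure IsCyclicSuperadditive (n k : ℕ) : Prop where
  add_le : ∀ x y, x + y ≤ k.choose n → plusPlus n x + plusPlus n y ≤ plusPlus n (x + y)
  wrap : ∀ p q t, p ≤ k.choose n → q ≤ k.choose n → p + q = k.choose n + t →
    plusPlus n p + plusPlus n q ≤ plusPlus n (k.choose n) + plusPlus n t

/-- With c fixed, the interval [0, C(n+1+c, n+1)] ends with a copy of [0, C(n+c, n)] in degree n. So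
the last v increments have the same sum in every degree from m on. -/
theorem plusPlus_choose_sub {m c : ℕ} (hm : 1 ≤ m) {v : ℕ} (hv : v ≤ (m + c).choose m) {n : ℕ}
    (hn : m ≤ n) : v ≤ (n + c).choose n ∧
    plusPlus n ((n + c).choose n - v) + plusPlus m ((m + c).choose m)
      = plusPlus n ((n + c).choose n) + plusPlus m ((m + c).choose m - v) := by
  induction n, hn using Nat.le_induction with
  | base => exact ⟨hv, add_comm _ _⟩
  | succ n hn ih =>
    obtain ⟨h0, h1⟩ := ih
    have e : (n + 1 + c).choose (n + 1) = (n + c).choose (n + 1) + (n + c).choose n := by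
      rw [show n + 1 + c = n + c + 1 by omega, Nat.choose_succ_succ', add_comm]
    refine ⟨by omega, ?_⟩
    rw [e, Nat.add_sub_assoc h0, plusPlus_succ_choose_add (by omega) (Nat.sub_le _ _),
      plusPlus_succ_choose_add (by omega) le_rfl]
    omega

/-- This compares the last d increments on two intervals: those in degree n with parameter c sum to
at most those in degree m ≤ n with parameter c + 1. The induction on m peels off the final block of
the latter interval. -/
theorem plusPlus_sub_le {n c : ℕ} (h : IsCyclicSuperadditive n (n + c)) {m : ℕ} (hm : 1 ≤ m) :
    m ≤ n → ∀ d, d ≤ (n + c).choose n → d ≤ (m + c + 1).choose m →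
      plusPlus n ((n + c).choose n) + plusPlus m ((m + c + 1).choose m - d)
        ≤ plusPlus m ((m + c + 1).choose m) + plusPlus n ((n + c).choose n - d) := by
  induction m, hm using Nat.le_induction with
  | base =>
    intro hmn d hd1 hd2
    rw [Nat.choose_one_right] at hd2 ⊢
    rcases Nat.eq_zero_or_pos d with rfl | hd
    · simp [add_comm]
    obtain ⟨v, rfl⟩ : ∃ v, d = v + 1 := ⟨d - 1, by omega⟩
    -- In degree 1 the increments are 1, 2, 3, …; the last v + 1 increments in degree n are at most
    -- the last v plus the last one, and both of these can be read off in degree 1.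
    obtain ⟨-, h1⟩ := plusPlus_choose_sub (c := c) le_rfl (v := 1) (by simp) hmn
    obtain ⟨-, h2⟩ := plusPlus_choose_sub (c := c) le_rfl (v := v) (by simp; omega) hmn
    have h3 := h.wrap ((n + c).choose n - v) ((n + c).choose n - 1)
      ((n + c).choose n - (v + 1)) (by omega) (by omega) (by omega)
    rw [Nat.choose_one_right] at h1 h2
    rw [show 1 + c - 1 = c by omega, show 1 + c = c + 1 by omega, plusPlus_one_succ] at h1
    rw [show 1 + c = c + 1 by omega, plusPlus_one_succ] at h2
    rw [show 1 + c + 1 = c + 1 + 1 by omega, plusPlus_one_succ, plusPlus_one_succ,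
      show c + 1 + 1 - (v + 1) = c + 1 - v by omega]
    omega
  | succ m hm ih =>
    intro hmn d hd1 hd2
    have ih := ih (by omega)
    have e : (m + 1 + c + 1).choose (m + 1)
        = (m + c + 1).choose (m + 1) + (m + c + 1).choose m := by
      rw [show m + 1 + c + 1 = m + c + 1 + 1 by omega, Nat.choose_succ_succ', add_comm]
    rw [e] at hd2 ⊢
    have eQ : plusPlus (m + 1) ((m + c + 1).choose (m + 1)) = (m + c + 1 + 1).choose (m + 2) :=
      plusPlus_choose (by omega) _
    rw [plusPlus_succ_choose_add (by omega) le_rfl]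
    rcases Nat.lt_or_ge ((m + c + 1).choose m) d with hd | hd
    · obtain ⟨v, rfl⟩ : ∃ v, d = (m + c + 1).choose m + v := ⟨d - (m + c + 1).choose m, by omega⟩
      have h1 := ih ((m + c + 1).choose m) (by omega) le_rfl
      rw [Nat.sub_self, plusPlus_zero] at h1
      -- When d exceeds the final block, `wrap` bounds the last d increments in degree n by the last
      -- C(m+c+1, m) plus the last v. The induction hypothesis handles the former; the latter agree
      -- with those in degree m + 1.
      obtain ⟨-, h2⟩ := plusPlus_choose_sub (c := c) (show 1 ≤ m + 1 by omega) (v := v)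
        (by rw [show m + 1 + c = m + c + 1 by omega]; omega) hmn
      have h3 := h.wrap ((n + c).choose n - v) ((n + c).choose n - (m + c + 1).choose m)
        ((n + c).choose n - ((m + c + 1).choose m + v)) (by omega) (by omega) (by omega)
      rw [show m + 1 + c = m + c + 1 by omega] at h2
      rw [show (m + c + 1).choose (m + 1) + (m + c + 1).choose m - ((m + c + 1).choose m + v)
        = (m + c + 1).choose (m + 1) - v by omega]
      omega
    · have h1 := ih d hd1 hd
      rw [Nat.add_sub_assoc hd, plusPlus_succ_choose_add (by omega) (Nat.sub_le _ _)]
      omega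

/-- Split x = C(k,n+1) + v: degree n+1 is additive on this splitting, with F_n(v) as second term,
while degree n is superadditive. If v = 0, Pascal's rule supplies a nontrivial splitting. -/
theorem plusPlus_succ_le {n : ℕ} (hn : 1 ≤ n) (h : ∀ k, IsCyclicSuperadditive n k) (x : ℕ) :
    plusPlus (n + 1) x ≤ plusPlus n x := by
  induction x using Nat.strong_induction_on with
  | _ x ih =>
    obtain ⟨k, h1, h2⟩ := exists_choose_le_lt (show 1 ≤ n + 1 by omega) x
    obtain ⟨v, rfl⟩ : ∃ v, x = k.choose (n + 1) + v := ⟨x - k.choose (n + 1), by omega⟩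
    rw [Nat.choose_succ_succ'] at h2
    have hv : v ≤ k.choose n := by omega
    rcases Nat.eq_zero_or_pos (k.choose (n + 1)) with h0 | h0
    · have hk : k ≤ n := by
        by_contra hlt
        have := Nat.choose_pos (n := k) (k := n + 1) (by omega)
        omega
      have : k.choose n ≤ 1 := by simpa using Nat.choose_le_choose n hk
      rw [h0, zero_add]
      obtain rfl | rfl : v = 0 ∨ v = 1 := by omega
      · simp [plusPlus_zero]
      · rw [plusPlus_one_right hn, plusPlus_one_right (by omega)]
    rcases Nat.eq_zero_or_pos v with rfl | hv0
    · rcases Nat.lt_or_ge (k.choose (n + 1)) 2 with h' | h'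
      · have : k.choose (n + 1) = 1 := by omega
        rw [this, add_zero, plusPlus_one_right hn, plusPlus_one_right (by omega)]
      · obtain ⟨j, rfl⟩ : ∃ j, k = j + 1 := by
          refine ⟨k - 1, ?_⟩
          rcases k with _ | k
          · simp at h0
          · omega
        have hj : j.choose (n + 1) < (j + 1).choose (n + 1) := by
          rw [Nat.choose_succ_succ']
          have := Nat.choose_pos (n := j) (k := n) (by
            by_contra hlt
            rw [Nat.choose_eq_zero_of_lt (by omega)] at h0
            omega)
          omega
        have hj0 : 0 < j.choose (n + 1) := by
          apply Nat.choose_pos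
          by_contra hlt
          have := Nat.choose_le_choose (n + 1) (show j + 1 ≤ n + 1 by omega)
          rw [Nat.choose_self] at this
          omega
        rw [add_zero] at ih ⊢
        have e := Nat.choose_succ_succ' j n
        have i1 := ih _ hj
        have i2 := plusPlus_succ_choose_add hn (k := j) le_rfl
        obtain ⟨l, -, hl⟩ := exists_choose_le_lt hn ((j + 1).choose (n + 1))
        have i3 := (h (l + 1)).add_le (j.choose (n + 1)) (j.choose n) (by omega)
        rw [e, add_comm (j.choose n), i2, ← plusPlus_choose (by omega)]
        omega
    · have i1 := ih (k.choose (n + 1)) (by omega)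
      obtain ⟨l, -, hl⟩ := exists_choose_le_lt hn (k.choose (n + 1) + v)
      have i3 := (h (l + 1)).add_le (k.choose (n + 1)) v (by omega)
      rw [plusPlus_succ_choose_add hn hv, ← plusPlus_choose (by omega)]
      omega

/-- On [0, K + M], with K = C(k,n+1) and M = C(k,n), the function is its restriction to [0, K]
followed by a copy of degree n on [0, M]. The cases record which arguments pass K. -/
theorem isCyclicSuperadditive_succ {n k : ℕ} (hn : 1 ≤ n)
    (hsc : ∀ x, plusPlus (n + 1) x ≤ plusPlus n x)
    (hK : IsCyclicSuperadditive (n + 1) k) (hM : IsCyclicSuperadditive n k) :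
    IsCyclicSuperadditive (n + 1) (k + 1) := by
  have hT : (k + 1).choose (n + 1) = k.choose (n + 1) + k.choose n := by
    rw [Nat.choose_succ_succ', add_comm]
  have hrec : ∀ v ≤ k.choose n, plusPlus (n + 1) (k.choose (n + 1) + v)
      = plusPlus (n + 1) (k.choose (n + 1)) + plusPlus n v := fun v hv => by
    rw [plusPlus_succ_choose_add hn hv, plusPlus_choose (by omega)]
  -- The last d increments of the lower piece are dominated by the last d of the upper piece.
  have hpc : ∀ d ≤ k.choose (n + 1), d ≤ k.choose n →
      plusPlus (n + 1) (k.choose (n + 1)) + plusPlus n (k.choose n - d)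
        ≤ plusPlus n (k.choose n) + plusPlus (n + 1) (k.choose (n + 1) - d) := by
    intro d h1 h2
    rcases Nat.lt_or_ge k (n + 1) with hk | hk
    · rw [Nat.choose_eq_zero_of_lt hk] at h1 ⊢
      obtain rfl : d = 0 := by omega
      simp [add_comm]
    · obtain ⟨c, rfl⟩ : ∃ c, k = n + 1 + c := ⟨k - (n + 1), by omega⟩
      have := plusPlus_sub_le hK hn (by omega) d h1
        (by rwa [show n + c + 1 = n + 1 + c by omega])
      rwa [show n + c + 1 = n + 1 + c by omega] at this
  obtain ⟨hKa, hKw⟩ := hK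
  obtain ⟨hMa, hMw⟩ := hM
  set K := k.choose (n + 1)
  set M := k.choose n
  -- one summand beyond `K`
  have big : ∀ x' y, x' + y ≤ M → plusPlus (n + 1) (K + x') + plusPlus (n + 1) y
      ≤ plusPlus (n + 1) (K + x' + y) := by
    intro x' y hxy
    rw [add_assoc, hrec x' (by omega), hrec _ hxy]
    have := hMa x' y hxy
    have := hsc y
    omega
  have mixed : ∀ p' q, p' ≤ M → q ≤ K → ∀ t, p' + q = M + t →
      plusPlus n p' + plusPlus (n + 1) q ≤ plusPlus n M + plusPlus (n + 1) t := by
    intro p' q hp hq t ht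
    have h1 := hpc (M - p') (by omega) (by omega)
    rw [show M - (M - p') = p' by omega] at h1
    have h2 := hKw q (K - (M - p')) t hq (by omega) (by omega)
    omega
  refine ⟨fun x y hxy => ?_, fun p q t hp hq ht => ?_⟩
  · rw [hT] at hxy
    rcases Nat.lt_or_ge K (x + y) with h | h
    · rcases Nat.lt_or_ge x K with hx | hx
      · rcases Nat.lt_or_ge y K with hy | hy
        · obtain ⟨t, ht⟩ : ∃ t, x + y = K + t := ⟨x + y - K, by omega⟩
          have h1 := hKw x y t (by omega) (by omega) ht
          have h2 := hsc t
          rw [ht, hrec t (by omega)]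
          omega
        · obtain ⟨y', rfl⟩ : ∃ y', y = K + y' := ⟨y - K, by omega⟩
          have := big y' x (by omega)
          rw [add_comm x]
          omega
      · obtain ⟨x', rfl⟩ : ∃ x', x = K + x' := ⟨x - K, by omega⟩
        exact big x' y (by omega)
    · exact hKa x y h
  · rw [hT] at hp hq ht ⊢
    rw [hrec M le_rfl]
    rcases Nat.lt_or_ge p K with hpK | hpK
    · rcases Nat.lt_or_ge q K with hqK | hqK
      · have h1 := hKw p q (M + t) hpK.le hqK.le (by omega)
        have h2 := mixed 0 (M + t) (by omega) (by omega) t (by omega)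
        rw [plusPlus_zero] at h2
        omega
      · obtain ⟨q', rfl⟩ : ∃ q', q = K + q' := ⟨q - K, by omega⟩
        rw [hrec q' (by omega)]
        have := mixed q' p (by omega) hpK.le t (by omega)
        omega
    · obtain ⟨p', rfl⟩ : ∃ p', p = K + p' := ⟨p - K, by omega⟩
      rw [hrec p' (by omega)]
      rcases Nat.lt_or_ge q K with hqK | hqK
      · have := mixed p' q (by omega) hqK.le t (by omega)
        omega
      · obtain ⟨q', rfl⟩ : ∃ q', q = K + q' := ⟨q - K, by omega⟩
        rw [hrec q' (by omega)]
        rcases Nat.lt_or_ge (p' + q') M with h | h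
        · have h1 := hpc (M - (p' + q')) (by omega) (by omega)
          have h2 := hMa p' q' h.le
          rw [show M - (M - (p' + q')) = p' + q' by omega,
            show K - (M - (p' + q')) = t by omega] at h1
          omega
        · obtain ⟨t', rfl⟩ : ∃ t', t = K + t' := ⟨t - K, by omega⟩
          rw [hrec t' (by omega)]
          have := hMw p' q' t' (by omega) (by omega) (by omega)
          omega

theorem isCyclicSuperadditive {n : ℕ} (hn : 1 ≤ n) :
    ∀ k, IsCyclicSuperadditive n k := by
  induction n, hn using Nat.le_induction with
  | base =>
    intro k
    refine ⟨fun x y _ => ?_, fun p q t hp hq ht => ?_⟩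
    · have h1 := two_mul_plusPlus_one x
      have h2 := two_mul_plusPlus_one y
      have h3 := two_mul_plusPlus_one (x + y)
      nlinarith [Nat.zero_le (x * y)]
    -- In degree 1 the function is a(a+1)/2, and the claim is its convexity.
    · rw [Nat.choose_one_right] at *
      have h1 := two_mul_plusPlus_one p
      have h2 := two_mul_plusPlus_one q
      have h3 := two_mul_plusPlus_one k
      have h4 := two_mul_plusPlus_one t
      obtain ⟨x, rfl⟩ : ∃ x, k = p + x := ⟨k - p, by omega⟩
      obtain rfl : q = t + x := by omega
      have : t ≤ p := by omega
      nlinarith [Nat.mul_le_mul_right x this]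
  | succ n hn ih =>
    intro k
    induction k with
    | zero =>
      refine ⟨fun x y h => ?_, fun p q t hp hq ht => ?_⟩
      · rw [Nat.choose_zero_succ] at h
        obtain ⟨rfl, rfl⟩ : x = 0 ∧ y = 0 := by omega
        simp [plusPlus_zero]
      · rw [Nat.choose_zero_succ] at *
        obtain ⟨rfl, rfl⟩ : p = 0 ∧ q = 0 := by omega
        simp [plusPlus_zero]
    | succ k ihk => exact isCyclicSuperadditive_succ hn (plusPlus_succ_le hn ih) ihk (ih k)

/-! ### Superadditivity, monotonicity and the two bounds used later -/

theorem plusPlus_add_le {n : ℕ} (hn : 1 ≤ n) (x y : ℕ) :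
    plusPlus n x + plusPlus n y ≤ plusPlus n (x + y) := by
  obtain ⟨k, -, h⟩ := exists_choose_le_lt hn (x + y)
  exact (isCyclicSuperadditive hn (k + 1)).add_le x y h.le

theorem plusPlus_strictMono {n : ℕ} (hn : 1 ≤ n) : StrictMono (plusPlus n) := by
  refine strictMono_nat_of_lt_succ fun x => ?_
  have := plusPlus_add_le hn x 1
  rw [plusPlus_one_right hn] at this
  omega

theorem le_plusPlus {n : ℕ} (hn : 1 ≤ n) (x : ℕ) : x ≤ plusPlus n x :=
  (plusPlus_strictMono hn).le_apply

/-- The numerical inequality behind the induction for Macaulay's theorem. -/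
theorem plusPlus_add_min_le {n : ℕ} (hn : 1 ≤ n) :
    ∀ a c m, m ≤ a + c → (c = 0 → m = 0) → (2 ≤ n → m ≤ plusPlus (n - 1) c) →
      plusPlus n a + m ≤ plusPlus n (a + c) := by
  induction n, hn using Nat.le_induction with
  | base =>
    intro a c m h1 h2 _
    rcases Nat.eq_zero_or_pos c with rfl | hc
    · simp [h2 rfl]
    · obtain ⟨c, rfl⟩ : ∃ c', c = c' + 1 := ⟨c - 1, by omega⟩
      have := (plusPlus_strictMono le_rfl).monotone (show a ≤ a + c by omega)
      rw [← add_assoc, plusPlus_one_succ]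
      omega
  | succ n hn ih =>
    intro a c m h1 h2 h3
    have h3 := h3 (by omega)
    rw [Nat.add_sub_cancel] at h3
    have mono := (plusPlus_strictMono hn).monotone
    have mono' := (plusPlus_strictMono (show 1 ≤ n + 1 by omega)).monotone
    obtain ⟨k, hk1, hk2⟩ := exists_choose_le_lt (show 1 ≤ n + 1 by omega) (a + c)
    obtain ⟨y, hy⟩ : ∃ y, a + c = k.choose (n + 1) + y := ⟨a + c - k.choose (n + 1), by omega⟩
    rw [Nat.choose_succ_succ'] at hk2
    have hyk : y ≤ k.choose n := by omega
    have key := plusPlus_succ_choose_add hn hyk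
    rcases Nat.lt_or_ge a (k.choose (n + 1)) with ha | ha
    · obtain ⟨j, rfl⟩ : ∃ j, k = j + 1 := by
        refine ⟨k - 1, ?_⟩
        rcases k with _ | k
        · simp at ha
        · omega
      have pas := Nat.choose_succ_succ' j n
      have pas' : (j + 2).choose (n + 2) = (j + 1).choose (n + 1) + (j + 1).choose (n + 2) :=
        Nat.choose_succ_succ' (j + 1) (n + 1)
      have hfull : plusPlus (n + 1) (j.choose (n + 1)) = (j + 1).choose (n + 2) :=
        plusPlus_choose (by omega) j
      have hfull' := plusPlus_choose hn j
      rw [hy, key, show j + 1 + 1 = j + 2 by omega]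
      -- For a below C(j,n+1) the hypothesis m ≤ a + c suffices. Otherwise a = C(j,n+1) + z, and z
      -- is compared with the remainder y of a + c.
      rcases Nat.lt_or_ge a (j.choose (n + 1)) with ha' | ha'
      · have i1 := mono' ha'.le
        have i2 := le_plusPlus hn y
        omega
      · obtain ⟨z, rfl⟩ : ∃ z, a = j.choose (n + 1) + z := ⟨a - j.choose (n + 1), by omega⟩
        have hz : z ≤ j.choose n := by omega
        rw [plusPlus_succ_choose_add hn hz]
        rcases Nat.lt_or_ge z y with hzy | hzy
        · obtain ⟨w, rfl⟩ : ∃ w, y = z + w := ⟨y - z, by omega⟩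
          have hc : c = j.choose n + w := by omega
          subst hc
          have hle : m ≤ (j + 1).choose (n + 1) + (z + w) := by omega
          rcases Nat.lt_or_ge m ((j + 1).choose (n + 1)) with hm | hm
          · have := mono (show z ≤ z + w by omega)
            omega
          -- Here c = C(j,n) + w, so the bound m ≤ F_n(c) passes to degree n − 1 after removing
          -- C(j+1,n+1). If w is too large for the recursion, the bound m ≤ a + c already gives what
          -- is needed.
          · have := ih z w (m - (j + 1).choose (n + 1)) (by omega) (by omega) (by
              intro hn2
              obtain ⟨l, rfl⟩ : ∃ l, n = l + 1 := ⟨n - 1, by omega⟩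
              rw [Nat.add_sub_cancel]
              rcases Nat.lt_or_ge (j.choose l) w with hw | hw
              · have i1 := (plusPlus_strictMono (show 1 ≤ l by omega)).monotone hw.le
                rw [plusPlus_choose (by omega)] at i1
                omega
              · rw [plusPlus_succ_choose_add (by omega) hw] at h3
                have e : (j + 1).choose (l + 2) = (j + 1).choose (l + 1 + 1) := rfl
                omega)
            omega
        · have i1 := (isCyclicSuperadditive hn j).wrap z c y hz (by omega) (by omega)
          omega
    · obtain ⟨z, rfl⟩ : ∃ z, a = k.choose (n + 1) + z := ⟨a - k.choose (n + 1), by omega⟩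
      rw [hy, key, plusPlus_succ_choose_add hn (by omega)]
      have := plusPlus_add_le hn z c
      rw [show z + c = y by omega] at this
      omega

/-- Add the values one at a time, keeping a running remainder below C(k,n): without a carry `add_le`
applies, with a carry `wrap` does. -/
theorem sum_plusPlus_le {ι : Type*} {n : ℕ} (hn : 1 ≤ n) (k : ℕ) (t : Finset ι) (h : ι → ℕ)
    (hle : ∀ i ∈ t, h i ≤ k.choose n) :
    ∀ q r, r < k.choose n → ∑ i ∈ t, h i = k.choose n * q + r →
      ∑ i ∈ t, plusPlus n (h i) ≤ (k + 1).choose (n + 1) * q + plusPlus n r := by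
  classical
  obtain ⟨Ca, Cw⟩ := isCyclicSuperadditive hn k
  have full := plusPlus_choose hn k
  set T := k.choose n
  induction t using Finset.induction_on with
  | empty => intro q r _ _; simp
  | insert a t ha ih =>
    intro q r hr hs
    rw [Finset.sum_insert ha] at hs ⊢
    have hT : 0 < T := by omega
    set S := ∑ i ∈ t, h i
    have ih := ih (fun i hi => hle i (Finset.mem_insert_of_mem hi)) (S / T) (S % T)
      (Nat.mod_lt _ hT) (Nat.div_add_mod S T).symm
    have hdm := Nat.div_add_mod S T
    have hmod := Nat.mod_lt S hT
    have hha := hle a (Finset.mem_insert_self _ _)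
    set q' := S / T
    set r' := S % T
    rcases Nat.lt_or_ge (h a + r') T with hlt | hge
    · have e : T * q + r = T * q' + (h a + r') := by omega
      have hq : q = q' := by
        have h1 : (T * q + r) / T = q := by
          rw [Nat.mul_add_div hT, Nat.div_eq_of_lt hr, add_zero]
        have h2 : (T * q' + (h a + r')) / T = q' := by
          rw [Nat.mul_add_div hT, Nat.div_eq_of_lt hlt, add_zero]
        rw [← h1, e, h2]
      rw [hq] at e ⊢
      obtain rfl : r = h a + r' := by omega
      have := Ca (h a) r' hlt.le
      omega
    · obtain ⟨u, hu⟩ : ∃ u, h a + r' = T + u := ⟨h a + r' - T, by omega⟩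
      have e : T * q + r = T * (q' + 1) + u := by rw [mul_add]; omega
      have hq : q = q' + 1 := by
        have h1 : (T * q + r) / T = q := by
          rw [Nat.mul_add_div hT, Nat.div_eq_of_lt hr, add_zero]
        have h2 : (T * (q' + 1) + u) / T = q' + 1 := by
          rw [Nat.mul_add_div hT, Nat.div_eq_of_lt (by omega), add_zero]
        rw [← h1, e, h2]
      rw [hq] at e ⊢
      obtain rfl : r = u := by omega
      have := Cw (h a) r' r hha hmod.le hu
      rw [mul_add]
      omega

/-! ### Macaulay's bound for sets of monomials -/

section Shadow

variable {σ : Type*}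

/-- The exponents `v` with `v + e_x ∈ B`. -/
noncomputable def divBy (x : σ) (B : Finset (σ →₀ ℕ)) : Finset (σ →₀ ℕ) :=
  B.preimage (· + Finsupp.single x 1) (add_left_injective _).injOn

theorem mem_divBy {x : σ} {B : Finset (σ →₀ ℕ)} {v : σ →₀ ℕ} :
    v ∈ divBy x B ↔ v + Finsupp.single x 1 ∈ B := by
  simp [divBy]

theorem exists_eq_add_single {u : σ →₀ ℕ} {x : σ} (h : u x ≠ 0) :
    ∃ v, u = v + Finsupp.single x 1 :=
  ⟨u - Finsupp.single x 1, (tsub_add_cancel_of_le (by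
    rw [Finsupp.single_le_iff]; omega)).symm⟩

theorem card_filter_add_card_divBy (x : σ) (B : Finset (σ →₀ ℕ)) :
    (B.filter fun u => u x = 0).card + (divBy x B).card = B.card := by
  classical
  rw [← Finset.card_filter_add_card_filter_not (s := B) (fun u => u x = 0)]
  congr 1
  refine Finset.card_bij (fun v _ => v + Finsupp.single x 1) ?_ ?_ ?_
  · intro v hv
    simpa using mem_divBy.1 hv
  · intro v _ w _ h
    exact add_right_cancel h
  · intro u hu
    rw [Finset.mem_filter] at hu
    obtain ⟨v, rfl⟩ := exists_eq_add_single hu.2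
    exact ⟨v, mem_divBy.2 hu.1, rfl⟩

theorem degree_add_single (v : σ →₀ ℕ) (x : σ) :
    (v + Finsupp.single x 1).degree = v.degree + 1 := by
  rw [map_add, Finsupp.degree_single]

/-- **Macaulay's theorem** for monomials: if all divisors of degree `n` of the monomials in `B'`,
of degree `n + 1`, are in `B`, then `|B'| ≤ (|B|_n)^+_+`. -/
theorem card_le_plusPlus {n : ℕ} (hn : 1 ≤ n) : ∀ (s : Finset σ) (B B' : Finset (σ →₀ ℕ)),
    (∀ u ∈ B', u.support ⊆ s ∧ u.degree = n + 1) →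
    (∀ v x, v + Finsupp.single x 1 ∈ B' → v ∈ B) → B'.card ≤ plusPlus n B.card := by
  classical
  induction n, hn using Nat.le_induction with
  | base =>
    intro s
    induction s using Finset.induction_on with
    | empty =>
      intro B B' h1 _
      rw [Finset.card_eq_zero.2]
      · exact Nat.zero_le _
      · refine Finset.eq_empty_of_forall_notMem fun u hu => ?_
        obtain ⟨h2, h3⟩ := h1 u hu
        rw [Finset.subset_empty, Finsupp.support_eq_empty] at h2
        simp [h2] at h3
    | insert x s hx ihs =>
      intro B B' h1 h2
      have i1 := ihs (B.filter fun u => u x = 0) (B'.filter fun u => u x = 0) (by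
        intro u hu
        rw [Finset.mem_filter] at hu
        refine ⟨?_, (h1 u hu.1).2⟩
        rw [← Finset.subset_insert_iff_of_notMem (a := x) (by simpa using hu.2)]
        exact (h1 u hu.1).1) (by
        intro v y hv
        rw [Finset.mem_filter] at hv ⊢
        refine ⟨h2 v y hv.1, ?_⟩
        have := hv.2
        rw [Finsupp.add_apply] at this
        omega)
      have i2 : (divBy x B').card ≤ B.card :=
        Finset.card_le_card fun v hv => h2 v x (mem_divBy.1 hv)
      rw [← card_filter_add_card_divBy x B] at i2 ⊢
      rw [← card_filter_add_card_divBy x B']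
      -- Here c counts the elements of B divisible by x. If c = 0, no element of B' is divisible by
      -- x: it has degree 2, and cancelling another factor would leave an element of B divisible by
      -- x.
      refine (Nat.add_le_add_right i1 _).trans
        (plusPlus_add_min_le le_rfl _ _ _ i2 (fun h0 => ?_) (by omega))
      rw [Finset.card_eq_zero] at h0 ⊢
      refine Finset.eq_empty_of_forall_notMem fun v hv => ?_
      have hv := mem_divBy.1 hv
      have hd := (h1 _ hv).2
      rw [degree_add_single] at hd
      obtain ⟨y, hy⟩ : ∃ y, v y ≠ 0 := by
        by_contra! hall
        have : v = 0 := Finsupp.ext hall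
        simp [this] at hd
      obtain ⟨w, rfl⟩ := exists_eq_add_single hy
      have := h2 (w + Finsupp.single x 1) y (by rwa [add_right_comm])
      rw [← mem_divBy, h0] at this
      simp at this
  | succ n hn ihn =>
    intro s
    induction s using Finset.induction_on with
    | empty =>
      intro B B' h1 _
      rw [Finset.card_eq_zero.2]
      · exact Nat.zero_le _
      · refine Finset.eq_empty_of_forall_notMem fun u hu => ?_
        obtain ⟨h2, h3⟩ := h1 u hu
        rw [Finset.subset_empty, Finsupp.support_eq_empty] at h2
        simp [h2] at h3
    | insert x s hx ihs =>
      intro B B' h1 h2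
      have i1 := ihs (B.filter fun u => u x = 0) (B'.filter fun u => u x = 0) (by
        intro u hu
        rw [Finset.mem_filter] at hu
        refine ⟨?_, (h1 u hu.1).2⟩
        rw [← Finset.subset_insert_iff_of_notMem (a := x) (by simpa using hu.2)]
        exact (h1 u hu.1).1) (by
        intro v y hv
        rw [Finset.mem_filter] at hv ⊢
        refine ⟨h2 v y hv.1, ?_⟩
        have := hv.2
        rw [Finsupp.add_apply] at this
        omega)
      have i2 : (divBy x B').card ≤ B.card :=
        Finset.card_le_card fun v hv => h2 v x (mem_divBy.1 hv)
      have i3 := ihn (insert x s) (divBy x B) (divBy x B') (by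
        intro v hv
        obtain ⟨h3, h4⟩ := h1 _ (mem_divBy.1 hv)
        rw [degree_add_single] at h4
        refine ⟨fun y hy => h3 ?_, by omega⟩
        rw [Finsupp.mem_support_iff] at hy ⊢
        rw [Finsupp.add_apply]
        omega) (by
        intro v y hv
        rw [mem_divBy] at hv ⊢
        exact h2 _ y (by rwa [add_right_comm]))
      rw [← card_filter_add_card_divBy x B] at i2 ⊢
      rw [← card_filter_add_card_divBy x B']
      -- The part of B' free of x is bounded by induction on the variables. The part divisible by x
      -- has two bounds: its quotients by x lie in B, and induction on the degree applies to them.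
      refine (Nat.add_le_add_right i1 _).trans
        (plusPlus_add_min_le (by omega) _ _ _ i2 (fun h0 => ?_) (fun _ => i3))
      rw [h0, plusPlus_zero] at i3
      omega

end Shadow

/-! ### The degree reverse lexicographical order -/

section Order

variable {b : ℕ}

theorem degRevLexLT_iff {u v : Fin b →₀ ℕ} (h : u.degree = v.degree) :
    DegRevLexLT u v ↔ ∃ i, v i < u i ∧ ∀ j, i < j → v j = u j := by
  rw [DegRevLexLT]
  simp [h]

theorem degRevLexLT_irrefl (u : Fin b →₀ ℕ) : ¬ DegRevLexLT u u := by
  rw [degRevLexLT_iff rfl]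
  rintro ⟨i, h, -⟩
  omega

theorem DegRevLexLT.trans {u v w : Fin b →₀ ℕ} (h : DegRevLexLT u v) (h' : DegRevLexLT v w) :
    DegRevLexLT u w := by
  rcases h with h | ⟨h, i, h1, h2⟩ <;> rcases h' with h' | ⟨h', j, h3, h4⟩
  · exact Or.inl (h.trans h')
  · exact Or.inl (h' ▸ h)
  · exact Or.inl (h ▸ h')
  · refine Or.inr ⟨h.trans h', ?_⟩
    rcases lt_trichotomy i j with hij | rfl | hij
    · exact ⟨j, by rw [← h2 j hij]; exact h3, fun l hl => by rw [h4 l hl, h2 l (hij.trans hl)]⟩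
    · exact ⟨i, h3.trans h1, fun l hl => by rw [h4 l hl, h2 l hl]⟩
    · exact ⟨i, by rw [h4 i hij]; exact h1, fun l hl => by rw [h4 l (hij.trans hl), h2 l hl]⟩

theorem degRevLexLT_total {u v : Fin b →₀ ℕ} (hne : u ≠ v) :
    DegRevLexLT u v ∨ DegRevLexLT v u := by
  rcases lt_trichotomy u.degree v.degree with h | h | h
  · exact Or.inl (Or.inl h)
  · obtain ⟨i, hi, hmax⟩ := Finset.exists_max_image
      (Finset.univ.filter fun i => u i ≠ v i) id (by
        obtain ⟨i, hi⟩ := Finsupp.ne_iff.1 hne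
        exact ⟨i, by simpa using hi⟩)
    simp only [Finset.mem_filter, Finset.mem_univ, true_and, id] at hi hmax
    have heq : ∀ j, i < j → u j = v j := fun j hj => by
      by_contra hj'
      exact absurd (hmax j hj') (not_le.2 hj)
    rw [degRevLexLT_iff h, degRevLexLT_iff h.symm]
    rcases Nat.lt_or_gt_of_ne hi with hlt | hlt
    · exact Or.inr ⟨i, hlt, heq⟩
    · exact Or.inl ⟨i, hlt, fun j hj => (heq j hj).symm⟩
  · exact Or.inr (Or.inl h)

/-- The exponents of degree `n`. -/
noncomputable def exponents (b n : ℕ) : Finset (Fin b →₀ ℕ) :=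
  Finset.univ.finsuppAntidiag n

theorem mem_exponents {n : ℕ} {u : Fin b →₀ ℕ} : u ∈ exponents b n ↔ u.degree = n := by
  rw [exponents, Finset.mem_finsuppAntidiag, Finsupp.degree_eq_sum]
  simp

theorem card_exponents (hb : 1 ≤ b) (n : ℕ) :
    (exponents b n).card = (n + b - 1).choose (b - 1) := by
  rw [exponents, Finset.card_finsuppAntidiag_nat_eq_choose, Finset.card_univ, Fintype.card_fin,
    add_comm b, ← Nat.choose_symm_of_eq_add (show n + b - 1 = (b - 1) + n by omega)]

open Classical in
/-- The number of larger exponents of the same degree. -/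
noncomputable def rank (u : Fin b →₀ ℕ) : ℕ :=
  ((exponents b u.degree).filter fun v => DegRevLexLT u v).card

theorem rank_zero : rank (0 : Fin b →₀ ℕ) = 0 := by
  classical
  rw [rank, Finset.card_eq_zero, Finset.filter_eq_empty_iff]
  intro v hv
  rw [mem_exponents, map_zero, Finsupp.degree_eq_zero_iff] at hv
  rw [hv]
  exact degRevLexLT_irrefl 0

/-- A larger monomial of the same degree cannot involve a variable after the i-th. This is the size
condition needed to apply `plusPlus_succ_choose_add` to ranks. -/
theorem rank_le_choose {w : Fin b →₀ ℕ} {i : Fin b} (hw : ∀ j, i < j → w j = 0) :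
    rank w ≤ (w.degree + i).choose w.degree := by
  classical
  have e : (w.degree + i).choose w.degree = ((Finset.Iic i).finsuppAntidiag w.degree).card := by
    rw [Finset.card_finsuppAntidiag_nat_eq_choose, Fin.card_Iic]
    congr 1
    omega
  rw [e, rank]
  refine Finset.card_le_card fun v hv => ?_
  rw [Finset.mem_filter, mem_exponents] at hv
  obtain ⟨hd, hlt⟩ := hv
  obtain ⟨k, hk, hk'⟩ := (degRevLexLT_iff hd.symm).1 hlt
  have hki : k ≤ i := by
    by_contra h
    rw [hw k (not_le.1 h)] at hk
    omega
  have hsupp : v.support ⊆ Finset.Iic i := by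
    intro j hj
    rw [Finset.mem_Iic]
    by_contra h
    rw [not_le] at h
    rw [Finsupp.mem_support_iff, hk' j (hki.trans_lt h), hw j h] at hj
    exact hj rfl
  rw [Finset.mem_finsuppAntidiag]
  refine ⟨?_, hsupp⟩
  rw [← hd]
  exact (Finset.sum_subset hsupp fun j _ hj => Finsupp.notMem_support_iff.1 hj).symm

/-- The larger monomials either involve only variables before the i-th, which the binomial
coefficient counts, or are X_i times a monomial larger than X^w. -/
theorem rank_add_single {w : Fin b →₀ ℕ} {i : Fin b} (hw : ∀ j, i < j → w j = 0) :
    rank (w + Finsupp.single i 1) = (w.degree + i).choose (w.degree + 1) + rank w := by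
  classical
  have e : (w.degree + i).choose (w.degree + 1)
      = ((Finset.Iio i).finsuppAntidiag (w.degree + 1)).card := by
    rw [Finset.card_finsuppAntidiag_nat_eq_choose, Fin.card_Iio]
    congr 1
    omega
  rw [e, rank, rank, degree_add_single,
    ← Finset.card_map (addRightEmbedding (Finsupp.single i 1))
      (s := (exponents b w.degree).filter fun v => DegRevLexLT w v), ← Finset.card_union_of_disjoint]
  · congr 1
    ext v
    rw [Finset.mem_filter, mem_exponents, Finset.mem_union, Finset.mem_finsuppAntidiag,
      Finset.mem_map]
    constructor
    · rintro ⟨hd, hlt⟩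
      rw [degRevLexLT_iff (by rw [degree_add_single, hd])] at hlt
      obtain ⟨k, hk, hk'⟩ := hlt
      have hki : k ≤ i := by
        by_contra h
        rw [not_le] at h
        rw [Finsupp.add_apply, hw k h, Finsupp.single_eq_of_ne h.ne'] at hk
        omega
      have hvi : ∀ j, i < j → v j = 0 := fun j hj => by
        rw [hk' j (hki.trans_lt hj), Finsupp.add_apply, hw j hj, Finsupp.single_eq_of_ne hj.ne',
          add_zero]
      by_cases h0 : v i = 0
      · left
        have hsupp : v.support ⊆ Finset.Iio i := by
          intro j hj
          rw [Finset.mem_Iio]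
          by_contra h
          rw [Finsupp.mem_support_iff] at hj
          rcases (not_lt.1 h).eq_or_lt with rfl | h
          · exact hj h0
          · exact hj (hvi j h)
        refine ⟨?_, hsupp⟩
        rw [← hd]
        exact (Finset.sum_subset hsupp fun j _ hj => Finsupp.notMem_support_iff.1 hj).symm
      · right
        obtain ⟨v, rfl⟩ := exists_eq_add_single h0
        rw [degree_add_single] at hd
        refine ⟨v, ?_, rfl⟩
        rw [Finset.mem_filter, mem_exponents, degRevLexLT_iff (by omega)]
        refine ⟨by omega, k, ?_, fun j hj => ?_⟩
        · rw [Finsupp.add_apply, Finsupp.add_apply] at hk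
          omega
        · have := hk' j hj
          rw [Finsupp.add_apply, Finsupp.add_apply] at this
          omega
    · rintro (⟨hd, hs⟩ | ⟨v, hv, rfl⟩)
      · have hz : ∀ j, i ≤ j → v j = 0 := fun j hj => by
          by_contra h
          exact absurd (Finset.mem_Iio.1 (hs (Finsupp.mem_support_iff.2 h))) (not_lt.2 hj)
        have hd' : v.degree = w.degree + 1 := by
          rw [← hd]
          exact Finset.sum_subset hs fun j _ hj => Finsupp.notMem_support_iff.1 hj
        refine ⟨hd', ?_⟩
        rw [degRevLexLT_iff (by rw [degree_add_single, hd'])]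
        refine ⟨i, ?_, fun j hj => ?_⟩
        · rw [hz i le_rfl, Finsupp.add_apply, Finsupp.single_eq_same]
          omega
        · rw [hz j hj.le, Finsupp.add_apply, hw j hj, Finsupp.single_eq_of_ne hj.ne', add_zero]
      · rw [Finset.mem_filter, mem_exponents] at hv
        obtain ⟨hd, hlt⟩ := hv
        obtain ⟨k, hk, hk'⟩ := (degRevLexLT_iff hd.symm).1 hlt
        have hd' : (v + Finsupp.single i 1).degree = w.degree + 1 := by
          rw [degree_add_single, hd]
        refine ⟨hd', ?_⟩
        change DegRevLexLT _ (v + Finsupp.single i 1)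
        rw [degRevLexLT_iff (by rw [degree_add_single, hd'])]
        refine ⟨k, ?_, fun j hj => ?_⟩
        · rw [Finsupp.add_apply, Finsupp.add_apply]
          omega
        · rw [Finsupp.add_apply, Finsupp.add_apply, hk' j hj]
  · rw [Finset.disjoint_left]
    intro v hv hv'
    rw [Finset.mem_map] at hv'
    obtain ⟨v, -, rfl⟩ := hv'
    rw [Finset.mem_finsuppAntidiag] at hv
    have : i ∈ Finset.Iio i := hv.2 (by simp [addRightEmbedding])
    simp at this

theorem exists_eq_add_single_last {u : Fin b →₀ ℕ} (h : u ≠ 0) :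
    ∃ w i, u = w + Finsupp.single i 1 ∧ ∀ j, i < j → w j = 0 := by
  obtain ⟨i, hi, hmax⟩ := Finset.exists_max_image u.support id (Finsupp.support_nonempty_iff.2 h)
  obtain ⟨w, rfl⟩ := exists_eq_add_single (Finsupp.mem_support_iff.1 hi)
  refine ⟨w, i, rfl, fun j hj => ?_⟩
  by_contra h0
  exact absurd (hmax j (by simp [h0])) (not_le.2 hj)

/-- Removing the last variable from w turns `rank_add_single` into the recursion for `plusPlus`, on
both sides. -/
theorem rank_add_single_bot {z : Fin b} (hz : ∀ j, z ≤ j) {n : ℕ} (hn : 1 ≤ n) :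
    ∀ w : Fin b →₀ ℕ, w.degree = n → rank (w + Finsupp.single z 1) = plusPlus n (rank w) := by
  have hz0 : (z : ℕ) = 0 := by
    have := hz ⟨0, by have := z.2; omega⟩
    rw [Fin.le_def] at this
    exact Nat.le_zero.1 this
  induction n, hn using Nat.le_induction with
  | base =>
    intro w hw
    obtain ⟨w, i, rfl, hi⟩ := exists_eq_add_single_last (u := w) (by rintro rfl; simp at hw)
    rw [degree_add_single, Nat.add_eq_right, Finsupp.degree_eq_zero_iff] at hw
    subst hw
    rw [add_right_comm, rank_add_single, rank_add_single, rank_add_single, degree_add_single,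
      rank_zero, plusPlus_one_left]
    · simp [hz0, add_comm]
    · simp
    · simp
    · intro j hj
      rw [zero_add, Finsupp.single_eq_of_ne ((hz i).trans_lt hj).ne']
  | succ n hn ih =>
    intro w hw
    obtain ⟨w, i, rfl, hi⟩ := exists_eq_add_single_last (u := w) (by rintro rfl; simp at hw)
    rw [degree_add_single, Nat.add_right_cancel_iff] at hw
    rw [add_right_comm, rank_add_single hi, rank_add_single, degree_add_single, ih w hw, hw,
      plusPlus_succ_choose_add hn]
    · rw [show n + 1 + i = n + i + 1 by omega]
    · rw [← hw]
      exact rank_le_choose hi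
    · intro j hj
      rw [Finsupp.add_apply, hi j hj, Finsupp.single_eq_of_ne ((hz i).trans_lt hj).ne', add_zero]

theorem rank_anti {u v : Fin b →₀ ℕ} (h : DegRevLexLT u v) (hd : u.degree = v.degree) :
    rank v < rank u := by
  classical
  rw [rank, rank, hd]
  refine Finset.card_lt_card (Finset.ssubset_iff_of_subset ?_ |>.2 ⟨v, ?_, ?_⟩)
  · intro w hw
    rw [Finset.mem_filter] at hw ⊢
    exact ⟨hw.1, h.trans hw.2⟩
  · rw [Finset.mem_filter, mem_exponents]
    exact ⟨rfl, h⟩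
  · rw [Finset.mem_filter]
    exact fun h' => degRevLexLT_irrefl v h'.2

/-- The first variable yields the largest multiple of X^w in the next degree, hence the one of
smallest rank. -/
theorem plusPlus_rank_le {w : Fin b →₀ ℕ} (hw : 1 ≤ w.degree) (j : Fin b) :
    plusPlus w.degree (rank w) ≤ rank (w + Finsupp.single j 1) := by
  have hb : 0 < b := by have := j.2; omega
  rw [← rank_add_single_bot (z := ⟨0, hb⟩) (fun j => Nat.zero_le _) hw w rfl]
  by_cases hj : j = ⟨0, hb⟩
  · rw [hj]
  · refine (rank_anti (Or.inr ⟨by simp only [degree_add_single], j, ?_, fun l hl => ?_⟩)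
      (by simp only [degree_add_single])).le
    · rw [Finsupp.add_apply, Finsupp.add_apply, Finsupp.single_eq_same,
        Finsupp.single_eq_of_ne hj]
      omega
    · rw [Finsupp.add_apply, Finsupp.add_apply, Finsupp.single_eq_of_ne hl.ne',
        Finsupp.single_eq_of_ne]
      rintro rfl
      exact absurd hl (not_lt.2 (Nat.zero_le _))

open Classical in
theorem card_lt_add_rank (u : Fin b →₀ ℕ) :
    ((exponents b u.degree).filter fun v => DegRevLexLT v u).card + rank u + 1
      = (exponents b u.degree).card := by
  have hsplit : exponents b u.degree
      = insert u (((exponents b u.degree).filter fun v => DegRevLexLT v u) ∪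
        ((exponents b u.degree).filter fun v => DegRevLexLT u v)) := by
    ext v
    rw [Finset.mem_insert, Finset.mem_union, Finset.mem_filter, Finset.mem_filter]
    constructor
    · intro hv
      by_cases h : v = u
      · exact Or.inl h
      · rcases degRevLexLT_total h with h | h
        · exact Or.inr (Or.inl ⟨hv, h⟩)
        · exact Or.inr (Or.inr ⟨hv, h⟩)
    · rintro (rfl | h | h)
      · exact mem_exponents.2 rfl
      · exact h.1
      · exact h.1
  conv_rhs => rw [hsplit]
  rw [Finset.card_insert_of_notMem, Finset.card_union_of_disjoint, rank]
  · rw [Finset.disjoint_left]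
    intro v h1 h2
    rw [Finset.mem_filter] at h1 h2
    exact degRevLexLT_irrefl v (h1.2.trans h2.2)
  · rw [Finset.mem_union, Finset.mem_filter, Finset.mem_filter]
    rintro (h | h) <;> exact degRevLexLT_irrefl u h.2

theorem rank_lt_card (u : Fin b →₀ ℕ) : rank u < (exponents b u.degree).card := by
  have := card_lt_add_rank u
  omega

theorem card_rank_lt {n r : ℕ} (hr : r ≤ (exponents b n).card) :
    ((exponents b n).filter fun u => rank u < r).card = r := by
  classical
  have hinj : Set.InjOn (rank (b := b)) (exponents b n : Set (Fin b →₀ ℕ)) := by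
    intro u hu v hv h
    rw [Finset.mem_coe, mem_exponents] at hu hv
    by_contra hne
    rcases degRevLexLT_total hne with h' | h'
    · exact (rank_anti h' (hu.trans hv.symm)).ne' h
    · exact (rank_anti h' (hv.trans hu.symm)).ne h
  have himg : (exponents b n).image rank = Finset.range (exponents b n).card := by
    refine Finset.eq_of_subset_of_card_le (fun x hx => ?_) ?_
    · obtain ⟨u, hu, rfl⟩ := Finset.mem_image.1 hx
      rw [mem_exponents] at hu
      subst hu
      exact Finset.mem_range.2 (rank_lt_card u)
    · rw [Finset.card_image_of_injOn hinj, Finset.card_range]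
  have : ((exponents b n).filter fun u => rank u < r).image rank = Finset.range r := by
    rw [← Finset.filter_image (p := fun x => x < r), himg]
    ext x
    simp only [Finset.mem_filter, Finset.mem_range]
    omega
  have hc := congrArg Finset.card this
  rwa [Finset.card_image_of_injOn (hinj.mono (Finset.coe_subset.2 (Finset.filter_subset _ _))),
    Finset.card_range] at hc

/-! ### The smallest submodules `J_i X^u` -/

/-- The largest `i` such that `J_i X^u` is among the `s * N - (N * q + r)` smallest elements of
`M_n(J)`, where `n = |u|` and `N` is the number of monomials of degree `n`. -/
noncomputable def segmentLevel (s q r : ℕ) (u : Fin b →₀ ℕ) : ℕ :=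
  if r ≤ rank u then s - q else s - q - 1

/-- Below (i, u) lie i − 1 full layers of monomials, and in layer i all monomials except X^u and the
larger ones. -/
theorem ncard_segmentLT {s n i : ℕ} {u : Fin b →₀ ℕ} (hi : 1 ≤ i) (his : i ≤ s)
    (hu : u.degree = n) :
    {p' ∈ segmentIndex b s n | SegmentLT p' (i, u)}.ncard + rank u + 1
      = i * (exponents b n).card := by
  classical
  subst hu
  have e : {p' ∈ segmentIndex b s u.degree | SegmentLT p' (i, u)}
      = ((Finset.Ico 1 i ×ˢ exponents b u.degree ∪
        {i} ×ˢ (exponents b u.degree).filter fun v => DegRevLexLT v u :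
          Finset (ℕ × (Fin b →₀ ℕ))) : Set (ℕ × (Fin b →₀ ℕ))) := by
    ext ⟨l, v⟩
    simp only [segmentIndex, SegmentLT, Set.mem_ofPred_eq, Finset.coe_union, Finset.coe_product,
      Set.mem_union, Set.mem_prod, Finset.mem_coe, Finset.mem_Ico, Finset.mem_singleton,
      Finset.mem_filter, mem_exponents]
    constructor
    · rintro ⟨⟨h1, h2, h3⟩, h4 | ⟨h4, h5⟩⟩
      · exact Or.inl ⟨⟨h1, h4⟩, h3⟩
      · exact Or.inr ⟨h4, h3, h5⟩
    · rintro (⟨⟨h1, h2⟩, h3⟩ | ⟨h1, h2, h3⟩)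
      · exact ⟨⟨h1, by omega, h3⟩, Or.inl h2⟩
      · exact ⟨⟨by omega, by omega, h2⟩, Or.inr ⟨h1, h3⟩⟩
  rw [e, Set.ncard_coe_finset, Finset.card_union_of_disjoint, Finset.card_product,
    Finset.card_product, Finset.card_singleton, one_mul, add_assoc, add_assoc, ← add_assoc _ _ 1,
    card_lt_add_rank, Nat.card_Ico]
  · obtain ⟨j, rfl⟩ : ∃ j, i = j + 1 := ⟨i - 1, by omega⟩
    simp [add_mul]
  · rw [Finset.disjoint_left]
    rintro ⟨l, v⟩ h1 h2
    rw [Finset.mem_product, Finset.mem_Ico] at h1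
    rw [Finset.mem_product, Finset.mem_singleton] at h2
    omega

theorem mem_smallestIndices_iff {s n m q r i : ℕ} {u : Fin b →₀ ℕ}
    (hr : r < (exponents b n).card)
    (hm : m + ((exponents b n).card * q + r) = s * (exponents b n).card) :
    (i, u) ∈ smallestIndices b s n m ↔ 1 ≤ i ∧ i ≤ segmentLevel s q r u ∧ u.degree = n := by
  rw [smallestIndices, Set.mem_sep_iff]
  set N := (exponents b n).card with hN
  have hqs : q ≤ s := by
    by_contra h
    have := Nat.mul_le_mul_left N (show s + 1 ≤ q by omega)
    rw [mul_comm s, mul_add] at *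
    omega
  have hlev : segmentLevel s q r u ≤ s - q := by
    rw [segmentLevel]
    split_ifs <;> omega
  -- The inequality to decide is iN − rank u − 1 < (s − q)N − r, where 0 ≤ rank u < N and 0 ≤ r < N.
  have key : 1 ≤ i → i ≤ s → u.degree = n →
      ({p' ∈ segmentIndex b s n | SegmentLT p' (i, u)}.ncard < m ↔
        i ≤ segmentLevel s q r u) := by
    intro h1 h2 h3
    have hc := ncard_segmentLT h1 h2 h3
    have hrk := rank_lt_card u
    rw [h3, ← hN] at hrk
    rw [← hN] at hc
    obtain ⟨c, rfl⟩ : ∃ c, s = q + c := ⟨s - q, by omega⟩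
    rw [add_mul, mul_comm q] at hm
    rw [segmentLevel, Nat.add_sub_cancel_left]
    rcases Nat.lt_trichotomy i c with h | h | h
    · have := Nat.mul_le_mul_right N (show i + 1 ≤ c by omega)
      rw [add_mul] at this
      refine iff_of_true (by omega) ?_
      split_ifs <;> omega
    · subst h
      split_ifs with h' <;> omega
    · have := Nat.mul_le_mul_right N (show c + 1 ≤ i by omega)
      rw [add_mul] at this
      refine iff_of_false (by omega) ?_
      split_ifs <;> omega
  simp only [segmentIndex, Set.mem_ofPred_eq]
  constructor
  · rintro ⟨⟨h1, h2, h3⟩, h4⟩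
    exact ⟨h1, (key h1 h2 h3).1 h4, h3⟩
  · rintro ⟨h1, h2, h3⟩
    exact ⟨⟨h1, by omega, h3⟩, (key h1 (by omega) h3).2 h2⟩

theorem segmentLevel_le_sub (s q r : ℕ) (u : Fin b →₀ ℕ) : segmentLevel s q r u ≤ s - q := by
  rw [segmentLevel]
  split_ifs <;> omega

theorem sum_segmentLevel {s n q r : ℕ} (hr : r < (exponents b n).card)
    (hqr : (exponents b n).card * q + r ≤ s * (exponents b n).card) :
    ∑ u ∈ exponents b n, segmentLevel s q r u + ((exponents b n).card * q + r)
      = s * (exponents b n).card := by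
  have hcard := card_rank_lt hr.le
  have hq : q ≤ s ∧ (r = 0 ∨ q + 1 ≤ s) := by
    constructor
    · by_contra h
      have := Nat.mul_le_mul_left (exponents b n).card (show s + 1 ≤ q by omega)
      rw [mul_comm s, mul_add] at *
      omega
    · by_contra! h
      have := Nat.mul_le_mul_left (exponents b n).card (show s ≤ q by omega)
      rw [mul_comm s] at hqr
      omega
  have e : ∀ u : Fin b →₀ ℕ, segmentLevel s q r u + (if rank u < r then 1 else 0) + q = s := by
    intro u
    rw [segmentLevel]
    split_ifs <;> omega
  have := Finset.sum_congr rfl fun u (_ : u ∈ exponents b n) => e u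
  rw [Finset.sum_add_distrib, Finset.sum_add_distrib, Finset.sum_const, Finset.sum_const,
    ← Finset.card_filter, hcard, smul_eq_mul, smul_eq_mul, mul_comm _ s] at this
  omega

end Order

/-! ### Lengths and leading coefficients -/

section Length

variable {R M M' : Type*} [CommRing R] [AddCommGroup M] [Module R M] [AddCommGroup M'] [Module R M']

theorem length_congr {P Q : Submodule R M} (h : P = Q) : Module.length R P = Module.length R Q := by
  rw [h]

theorem length_eq_length_inf_ker_add (P : Submodule R M) (f : M →ₗ[R] M') :
    Module.length R P
      = Module.length R (P ⊓ LinearMap.ker f : Submodule R M) + Module.length R (P.map f) := by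
  refine Module.length_eq_add_of_exact
    (Submodule.inclusion (inf_le_left : P ⊓ LinearMap.ker f ≤ P)) (f.submoduleMap P)
    (Submodule.inclusion_injective _) (LinearMap.submoduleMap_surjective f P) ?_
  intro x
  rw [← Subtype.coe_inj, LinearMap.submoduleMap_coe_apply]
  constructor
  · intro hx
    exact ⟨⟨x, x.2, hx⟩, rfl⟩
  · rintro ⟨y, rfl⟩
    exact y.2.2

variable {ι κ : Type*} [LinearOrder κ]

/-- The values at `u` of the functional `c u` on the elements of `P` on which all previous
functionals vanish. -/
def leadingValues (key : ι → κ) (c : ι → M →ₗ[R] R) (T : Finset ι) (P : Submodule R M) (u : ι) :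
    Submodule R R :=
  (P ⊓ ⨅ v ∈ T, ⨅ _ : key v < key u, LinearMap.ker (c v)).map (c u)

theorem mem_leadingValues {key : ι → κ} {c : ι → M →ₗ[R] R} {T : Finset ι} {P : Submodule R M}
    {u : ι} {x : R} : x ∈ leadingValues key c T P u ↔
      ∃ f ∈ P, (∀ v ∈ T, key v < key u → c v f = 0) ∧ c u f = x := by
  simp only [leadingValues, Submodule.mem_map, Submodule.mem_inf, Submodule.mem_iInf,
    LinearMap.mem_ker, and_assoc]

/-- Restricting P to the kernel of the functional with smallest key splits off the length of its
image; repeating this exhausts P, since the functionals jointly separate its elements from zero. -/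
theorem length_eq_sum_leadingValues {key : ι → κ} (hkey : Function.Injective key)
    (c : ι → M →ₗ[R] R) (T : Finset ι) : ∀ P : Submodule R M,
      (∀ f ∈ P, (∀ u ∈ T, c u f = 0) → f = 0) →
      Module.length R P = ∑ u ∈ T, Module.length R (leadingValues key c T P u) := by
  classical
  induction T using Finset.induction_on_min_value key with
  | empty =>
    intro P h
    have : P = ⊥ := (Submodule.eq_bot_iff P).2 fun f hf => h f hf (by simp)
    rw [this, Finset.sum_empty, Module.length_bot]
  | insert a T ha hmin ih =>
    intro P h
    have hlt : ∀ v ∈ T, key a < key v := fun v hv =>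
      (hmin v hv).lt_of_ne fun e => ha (by rwa [hkey e])
    rw [Finset.sum_insert ha, length_eq_length_inf_ker_add P (c a), ih, add_comm]
    · congr 1
      · refine length_congr ?_
        rw [leadingValues, eq_comm]
        congr 1
        rw [inf_eq_left]
        refine le_iInf₂ fun v hv => le_iInf fun hv' => ?_
        rcases Finset.mem_insert.1 hv with rfl | hv
        · exact absurd hv' (lt_irrefl _)
        · exact absurd hv' (hlt v hv).not_gt
      · refine Finset.sum_congr rfl fun u hu => ?_
        refine length_congr ?_
        ext x
        rw [mem_leadingValues, mem_leadingValues]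
        constructor
        · rintro ⟨f, ⟨hf, hf'⟩, h1, h2⟩
          refine ⟨f, hf, fun v hv hv' => ?_, h2⟩
          rcases Finset.mem_insert.1 hv with rfl | hv
          · exact hf'
          · exact h1 v hv hv'
        · rintro ⟨f, hf, h1, h2⟩
          exact ⟨f, ⟨hf, h1 a (Finset.mem_insert_self _ _) (hlt u hu)⟩,
            fun v hv => h1 v (Finset.mem_insert_of_mem hv), h2⟩
    · rintro f ⟨hf, hf'⟩ h0
      refine h f hf fun u hu => ?_
      rcases Finset.mem_insert.1 hu with rfl | hu
      · exact hf'
      · exact h0 u hu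

end Length

/-! ### Leading coefficients of ideals and the growth bound -/

section Ideals

variable {R₀ : Type*} [CommRing R₀] {b : ℕ}

theorem mem_gradedPart {I : Ideal (MvPolynomial (Fin b) R₀)} {n : ℕ}
    {f : MvPolynomial (Fin b) R₀} : f ∈ gradedPart I n ↔ f ∈ I ∧ f.IsHomogeneous n :=
  Iff.rfl

theorem eq_zero_of_coeff_exponents {n : ℕ} {f : MvPolynomial (Fin b) R₀} (hf : f.IsHomogeneous n)
    (h : ∀ u ∈ exponents b n, lcoeff R₀ u f = 0) : f = 0 := by
  ext u
  rw [coeff_zero]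
  by_cases hu : u.degree = n
  · exact h u (mem_exponents.2 hu)
  · exact hf.coeff_eq_zero hu

/-- The leading coefficients at `X^u` of the elements of degree `|u|` of `I`. -/
noncomputable def leadingCoeffs (I : Ideal (MvPolynomial (Fin b) R₀)) (u : Fin b →₀ ℕ) :
    Submodule R₀ R₀ :=
  leadingValues (MonomialOrder.lex (σ := Fin b)).toSyn (lcoeff R₀) (exponents b u.degree)
    (gradedPart I u.degree) u

theorem mem_leadingCoeffs {I : Ideal (MvPolynomial (Fin b) R₀)} {u : Fin b →₀ ℕ} {x : R₀} :
    x ∈ leadingCoeffs I u ↔ ∃ f ∈ I, f.IsHomogeneous u.degree ∧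
      (∀ v, (MonomialOrder.lex (σ := Fin b)).toSyn v < MonomialOrder.lex.toSyn u →
        coeff v f = 0) ∧ coeff u f = x := by
  rw [leadingCoeffs, mem_leadingValues]
  constructor
  · rintro ⟨f, hf, h1, h2⟩
    refine ⟨f, hf.1, hf.2, fun v hv => ?_, h2⟩
    by_cases hd : v.degree = u.degree
    · exact h1 v (mem_exponents.2 hd) hv
    · exact (mem_gradedPart.1 hf).2.coeff_eq_zero hd
  · rintro ⟨f, hf, hf', h1, h2⟩
    exact ⟨f, ⟨hf, hf'⟩, fun v _ hv => h1 v hv, h2⟩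

theorem length_gradedPart (I : Ideal (MvPolynomial (Fin b) R₀)) (n : ℕ) :
    Module.length R₀ (gradedPart I n)
      = ∑ u ∈ exponents b n, Module.length R₀ (leadingCoeffs I u) := by
  rw [length_eq_sum_leadingValues (MonomialOrder.lex (σ := Fin b)).toSyn.injective (lcoeff R₀)
    (exponents b n) (gradedPart I n) fun f hf => eq_zero_of_coeff_exponents (mem_gradedPart.1 hf).2]
  refine Finset.sum_congr rfl fun u hu => ?_
  rw [mem_exponents] at hu
  subst hu
  rfl

/-- Multiplication by X_j shifts exponents, and the lex order is compatible with addition. -/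
theorem leadingCoeffs_le_add_single (I : Ideal (MvPolynomial (Fin b) R₀)) (u : Fin b →₀ ℕ)
    (j : Fin b) : leadingCoeffs I u ≤ leadingCoeffs I (u + Finsupp.single j 1) := by
  intro x hx
  rw [mem_leadingCoeffs] at hx ⊢
  obtain ⟨f, hf, hf', h1, h2⟩ := hx
  refine ⟨f * X j, I.mul_mem_right _ hf, ?_, fun v hv => ?_, ?_⟩
  · rw [degree_add_single]
    exact hf'.mul (isHomogeneous_X R₀ j)
  · by_cases h0 : v j = 0
    · rw [coeff_mul_X', if_neg (by simpa using h0)]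
    · obtain ⟨w, rfl⟩ := exists_eq_add_single h0
      rw [coeff_mul_X]
      rw [map_add, map_add] at hv
      exact h1 w (lt_of_add_lt_add_right hv)
  · rw [coeff_mul_X, h2]

theorem length_homogeneousSubmodule (n : ℕ) :
    Module.length R₀ (homogeneousSubmodule (Fin b) R₀ n)
      = (exponents b n).card * Module.length R₀ R₀ := by
  have e : homogeneousSubmodule (Fin b) R₀ n = gradedPart ⊤ n := by
    ext f
    rw [mem_gradedPart, mem_homogeneousSubmodule]
    simp
  rw [e, length_gradedPart, Finset.sum_congr rfl fun u hu => ?_, Finset.sum_const, nsmul_eq_mul]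
  have : leadingCoeffs (⊤ : Ideal (MvPolynomial (Fin b) R₀)) u = ⊤ := by
    rw [eq_top_iff]
    intro x _
    rw [mem_leadingCoeffs]
    refine ⟨monomial u x, Submodule.mem_top, isHomogeneous_monomial x rfl, fun v hv => ?_, ?_⟩
    · rw [coeff_monomial, if_neg]
      rintro rfl
      exact lt_irrefl _ hv
    · rw [coeff_monomial, if_pos rfl]
  rw [this, Module.length_top]

theorem length_gradedPart_add_hilbertFunction (I : Ideal (MvPolynomial (Fin b) R₀)) (n : ℕ) :
    Module.length R₀ (gradedPart I n) + hilbertFunction I n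
      = (exponents b n).card * Module.length R₀ R₀ := by
  rw [← length_homogeneousSubmodule, length_eq_length_inf_ker_add
    (homogeneousSubmodule (Fin b) R₀ n) (Ideal.Quotient.mkₐ R₀ I).toLinearMap, hilbertFunction]
  congr 1
  refine length_congr ?_
  have : gradedPart I n = homogeneousSubmodule (Fin b) R₀ n ⊓
      LinearMap.ker (Ideal.Quotient.mkₐ R₀ I).toLinearMap := by
    ext f
    rw [mem_gradedPart, Submodule.mem_inf, LinearMap.mem_ker, and_comm]
    exact and_congr Iff.rfl (Ideal.Quotient.eq_zero_iff_mem (I := I) (a := f)).symm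
  rw [this]

theorem coeff_zero_eq_zero {I : Ideal (MvPolynomial (Fin b) R₀)}
    (hI : IsHomogeneousInIrrelevant I) {f : MvPolynomial (Fin b) R₀} (hf : f ∈ I) :
    coeff 0 f = 0 := by
  have h := hI.2 hf
  rw [HomogeneousIdeal.mem_iff, HomogeneousIdeal.mem_irrelevant_iff] at h
  have h' : homogeneousComponent 0 f = 0 := by
    rw [← h, ← decomposition.decompose'_apply]
    rfl
  rw [homogeneousComponent_zero] at h'
  simpa using h'

theorem gradedPart_zero {I : Ideal (MvPolynomial (Fin b) R₀)}
    (hI : IsHomogeneousInIrrelevant I) : gradedPart I 0 = ⊥ := by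
  rw [Submodule.eq_bot_iff]
  intro f hf
  refine eq_zero_of_coeff_exponents hf.2 fun u hu => ?_
  rw [mem_exponents, Finsupp.degree_eq_zero_iff] at hu
  rw [hu]
  exact coeff_zero_eq_zero hI hf.1

theorem card_exponents_zero : (exponents b 0).card = 1 := by
  rw [Finset.card_eq_one]
  refine ⟨0, ?_⟩
  ext u
  rw [mem_exponents, Finset.mem_singleton, Finsupp.degree_eq_zero_iff]

theorem card_exponents_eq_choose (hb : 1 ≤ b) (n : ℕ) :
    (exponents b n).card = (n + b - 1).choose n := by
  rw [card_exponents hb, Nat.choose_symm_of_eq_add (show n + b - 1 = n + (b - 1) by omega)]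

theorem card_exponents_succ (hb : 1 ≤ b) (n : ℕ) :
    (exponents b (n + 1)).card = (n + b - 1 + 1).choose (n + 1) := by
  rw [card_exponents_eq_choose hb]
  congr 1
  omega

/-- The bound for the growth of the Hilbert function of `R / I`. -/
theorem numericalCondition_of_ideal [IsArtinianRing R₀] (hb : 1 ≤ b) {H q r : ℕ → ℕ}
    (hdiv : ∀ n, H n = (n + b - 1).choose (b - 1) * q n + r n)
    (hr : ∀ n, r n < (n + b - 1).choose (b - 1))
    {I : Ideal (MvPolynomial (Fin b) R₀)} (hI : IsHomogeneousInIrrelevant I)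
    (hH : ∀ n, (H n : ℕ∞) = hilbertFunction I n) : NumericalCondition R₀ b H q r := by
  classical
  obtain ⟨s, hs⟩ : ∃ s : ℕ, (s : ℕ∞) = Module.length R₀ R₀ :=
    ⟨_, ENat.natCast_toNat Module.length_ne_top⟩
  have hg : ∀ u : Fin b →₀ ℕ, ∃ g : ℕ, (g : ℕ∞) = Module.length R₀ (leadingCoeffs I u) :=
    fun u => ⟨_, ENat.natCast_toNat Module.length_ne_top⟩
  choose g hg using hg
  have hgs : ∀ u, g u ≤ s := fun u => by
    have : (g u : ℕ∞) ≤ s := by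
      rw [hg, hs]
      exact Module.length_le_of_injective _ (Submodule.injective_subtype _)
    exact_mod_cast this
  have hgm : ∀ u j, g u ≤ g (u + Finsupp.single j 1) := fun u j => by
    have : (g u : ℕ∞) ≤ g (u + Finsupp.single j 1) := by
      rw [hg, hg]
      exact Module.length_le_of_injective _
        (Submodule.inclusion_injective (leadingCoeffs_le_add_single I u j))
    exact_mod_cast this
  have hsum : ∀ n, ∑ u ∈ exponents b n, g u + H n = (exponents b n).card * s := fun n => by
    have h1 := length_gradedPart_add_hilbertFunction I n
    rw [length_gradedPart, ← hH, ← hs, Finset.sum_congr rfl fun u _ => (hg u).symm] at h1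
    exact_mod_cast h1
  have h0 : H 0 = s := by
    have h1 := length_gradedPart_add_hilbertFunction I 0
    rw [gradedPart_zero hI, Module.length_bot, card_exponents_zero, ← hH, ← hs] at h1
    simpa using h1
  refine ⟨by rw [h0, hs], fun n => ?_⟩
  have hcard := card_exponents_eq_choose hb n
  have hcard' := card_exponents_succ hb n
  have hN := card_exponents hb n
  have hN' := card_exponents hb (n + 1)
  have e1 : n + 1 + b - 1 = n + b := by omega
  rw [e1] at hN'
  rw [← hN', hcard']
  have hHn := hdiv n
  have hrn := hr n
  rw [← hN] at hHn hrn
  rcases Nat.eq_zero_or_pos n with rfl | hn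
  · rw [card_exponents_zero] at hHn hrn
    have := hsum 1
    rw [← hcard', zero_add]
    have hq : q 0 = s := by omega
    rw [hq]
    omega
  -- Each u lies in exactly s − g(u) of the layers i < s, and monotonicity of g makes every layer
  -- closed under divisors.
  set B : ℕ → ℕ → Finset (Fin b →₀ ℕ) := fun i n => (exponents b n).filter fun u => g u ≤ i
  have hB : ∀ n, H n = ∑ i ∈ Finset.range s, (B i n).card := fun n => by
    have h1 : ∑ i ∈ Finset.range s, (B i n).card = ∑ u ∈ exponents b n, (s - g u) := by
      simp only [B, Finset.card_filter]
      rw [Finset.sum_comm]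
      refine Finset.sum_congr rfl fun u _ => ?_
      rw [← Finset.card_filter]
      have : (Finset.range s).filter (fun i => g u ≤ i) = Finset.Ico (g u) s := by
        ext i
        simp only [Finset.mem_filter, Finset.mem_range, Finset.mem_Ico]
        omega
      rw [this, Nat.card_Ico]
    have h2 : ∑ u ∈ exponents b n, (s - g u) + ∑ u ∈ exponents b n, g u
        = (exponents b n).card * s := by
      rw [← Finset.sum_add_distrib, Finset.sum_congr rfl fun u _ => Nat.sub_add_cancel (hgs u),
        Finset.sum_const, smul_eq_mul]
    have := hsum n
    omega
  have hmac : ∀ i, (B i (n + 1)).card ≤ plusPlus n (B i n).card := fun i => by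
    refine card_le_plusPlus hn Finset.univ _ _ (fun u hu => ?_) fun v x hv => ?_
    · rw [Finset.mem_filter, mem_exponents] at hu
      exact ⟨Finset.subset_univ _, hu.1⟩
    · rw [Finset.mem_filter, mem_exponents] at hv ⊢
      rw [degree_add_single] at hv
      exact ⟨by omega, (hgm v x).trans hv.2⟩
  rw [hB (n + 1)]
  refine (Finset.sum_le_sum fun i _ => hmac i).trans
    (sum_plusPlus_le hn _ _ _ (fun i _ => ?_) _ _ (hcard ▸ hrn) ?_)
  · rw [← hcard]
    exact Finset.card_filter_le _ _
  · rw [← hB, hHn, hcard]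

/-- The polynomials whose coefficient at `X^u` is in `L u`, for all `u`. -/
def coeffIdeal (L : (Fin b →₀ ℕ) → Submodule R₀ R₀)
    (hL : ∀ u j, L u ≤ L (u + Finsupp.single j 1)) : Ideal (MvPolynomial (Fin b) R₀) where
  carrier := {f | ∀ u, coeff u f ∈ L u}
  add_mem' := fun hf hg u => by
    rw [coeff_add]
    exact (L u).add_mem (hf u) (hg u)
  zero_mem' := fun u => by
    rw [coeff_zero]
    exact (L u).zero_mem
  smul_mem' := fun p => by
    induction p using MvPolynomial.induction_on with
    | C a =>
      intro f hf u
      rw [smul_eq_mul, coeff_C_mul]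
      exact (L u).smul_mem a (hf u)
    | add p p' hp hp' =>
      intro f hf u
      rw [smul_eq_mul, add_mul, coeff_add]
      exact (L u).add_mem (hp hf u) (hp' hf u)
    | mul_X p j hp =>
      intro f hf u
      have e : (p * X j) • f = (p • f) * X j := by
        rw [smul_eq_mul, smul_eq_mul, mul_right_comm]
      rw [e]
      by_cases h0 : u j = 0
      · rw [coeff_mul_X', if_neg (by simpa using h0)]
        exact (L u).zero_mem
      · obtain ⟨w, rfl⟩ := exists_eq_add_single h0
        rw [coeff_mul_X]
        exact hL w j (hp hf w)

variable {L : (Fin b →₀ ℕ) → Submodule R₀ R₀} {hL : ∀ u j, L u ≤ L (u + Finsupp.single j 1)}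

theorem mem_coeffIdeal {f : MvPolynomial (Fin b) R₀} :
    f ∈ coeffIdeal L hL ↔ ∀ u, coeff u f ∈ L u :=
  Iff.rfl

theorem monomial_mem_coeffIdeal {u : Fin b →₀ ℕ} {x : R₀} (hx : x ∈ L u) :
    monomial u x ∈ coeffIdeal L hL := by
  classical
  rw [mem_coeffIdeal]
  intro v
  rw [coeff_monomial]
  split_ifs with h
  · rwa [← h]
  · exact (L v).zero_mem

theorem isHomogeneousInIrrelevant_coeffIdeal (h0 : L 0 = ⊥) :
    IsHomogeneousInIrrelevant (coeffIdeal L hL) := by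
  constructor
  · intro n f hf
    have e : (DirectSum.decompose (homogeneousSubmodule (Fin b) R₀) f n : MvPolynomial (Fin b) R₀)
        = homogeneousComponent n f := decomposition.decompose'_apply f n
    rw [e]
    intro u
    rw [coeff_homogeneousComponent]
    split_ifs
    · exact hf u
    · exact (L u).zero_mem
  · intro f hf
    rw [HomogeneousIdeal.mem_iff, HomogeneousIdeal.mem_irrelevant_iff]
    have e : GradedRing.proj (homogeneousSubmodule (Fin b) R₀) 0 f
        = homogeneousComponent 0 f := decomposition.decompose'_apply f 0
    have h := hf 0
    rw [h0, Submodule.mem_bot] at h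
    rw [e, homogeneousComponent_zero, h, C_0]

theorem leadingCoeffs_coeffIdeal (u : Fin b →₀ ℕ) : leadingCoeffs (coeffIdeal L hL) u = L u := by
  ext x
  rw [mem_leadingCoeffs]
  constructor
  · rintro ⟨f, hf, -, -, rfl⟩
    exact hf u
  · intro hx
    refine ⟨monomial u x, monomial_mem_coeffIdeal hx, isHomogeneous_monomial x rfl,
      fun v hv => ?_, ?_⟩
    · rw [coeff_monomial, if_neg]
      rintro rfl
      exact lt_irrefl _ hv
    · rw [coeff_monomial, if_pos rfl]

end Ideals

/-! ### Composition series -/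

section Series

variable {R₀ : Type*} [CommRing R₀]

theorem length_eq_add_one_of_covBy {A B : Submodule R₀ R₀} (h : A ⋖ B) :
    Module.length R₀ B = Module.length R₀ A + 1 := by
  have := (covBy_iff_quot_is_simple h.le).1 h
  rw [Module.length_eq_add_of_exact (Submodule.inclusion h.le)
    (Submodule.comap B.subtype A).mkQ (Submodule.inclusion_injective _)
    (Submodule.mkQ_surjective _), Module.length_eq_one R₀ (B ⧸ Submodule.comap B.subtype A)]
  rw [LinearMap.exact_iff, Submodule.ker_mkQ, Submodule.range_inclusion]

variable {J : CompositionSeries (Submodule R₀ R₀)}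

theorem seriesTerm_eq {i : ℕ} (hi : i < J.length + 1) : seriesTerm J i = J ⟨i, hi⟩ := by
  rw [seriesTerm]
  congr 1
  ext
  exact Nat.mod_eq_of_lt hi

theorem seriesTerm_zero (hJ : J.head = ⊥) : seriesTerm J 0 = ⊥ := by
  rw [seriesTerm_eq (Nat.succ_pos _), ← hJ]
  rfl

theorem seriesTerm_mono {i j : ℕ} (hij : i ≤ j) (hj : j ≤ J.length) :
    seriesTerm J i ≤ seriesTerm J j := by
  rw [seriesTerm_eq (by omega), seriesTerm_eq (by omega)]
  exact J.strictMono.monotone hij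

theorem length_seriesTerm (hJ : J.head = ⊥) {i : ℕ} :
    i ≤ J.length → Module.length R₀ (seriesTerm J i) = i := by
  induction i with
  | zero => intro _; rw [seriesTerm_zero hJ, Module.length_bot, Nat.cast_zero]
  | succ i ih =>
    intro hi
    have h := J.step ⟨i, hi⟩
    have h' : seriesTerm J i ⋖ seriesTerm J (i + 1) := by
      rw [seriesTerm_eq (by omega), seriesTerm_eq (by omega)]
      exact h
    rw [length_eq_add_one_of_covBy h', ih (by omega), Nat.cast_add, Nat.cast_one]

end Series

/-! ### The segment ideal with a given Hilbert function -/

section Segment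

variable {R₀ : Type*} [CommRing R₀] {b : ℕ} {H q r : ℕ → ℕ}

/-- Since r(n) < N_n, the value of `plusPlus n` at r(n) is below N_{n+1}. The right side of the
condition is therefore itself a Euclidean division, and quotients can be compared before remainders.
-/
theorem NumericalCondition.quotient_antitone (hb : 1 ≤ b)
    (hdiv : ∀ n, H n = (exponents b n).card * q n + r n)
    (hr : ∀ n, r n < (exponents b n).card)
    (h : NumericalCondition R₀ b H q r) (n : ℕ) :
    q (n + 1) ≤ q n ∧ (q (n + 1) = q n → r (n + 1) ≤ plusPlus n (r n)) := by
  have h1 := h.2 n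
  have hN' := card_exponents hb (n + 1)
  rw [show n + 1 + b - 1 = n + b by omega] at hN'
  rw [← hN', hdiv] at h1
  have hlt : plusPlus n (r n) < (exponents b (n + 1)).card := by
    rcases Nat.eq_zero_or_pos n with rfl | hn
    · have h2 := hr 0
      rw [card_exponents_zero] at h2
      rw [show r 0 = 0 by omega, plusPlus_zero]
      exact (Nat.zero_le _).trans_lt (hr 1)
    · have h2 := plusPlus_strictMono hn (hr n)
      rwa [card_exponents_eq_choose hb n, plusPlus_choose hn, ← card_exponents_succ hb] at h2
  set N' := (exponents b (n + 1)).card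
  constructor
  · by_contra hlt'
    have := Nat.mul_le_mul_left N' (show q n + 1 ≤ q (n + 1) by omega)
    rw [mul_add] at this
    omega
  · intro e
    rw [e] at h1
    omega

/-- The equality q(0) = s propagates through `quotient_antitone`. This ensures that level s − q − 1
is never wanted when s = q, where the subtraction would truncate. -/
theorem NumericalCondition.quotient_le (hb : 1 ≤ b)
    (hdiv : ∀ n, H n = (exponents b n).card * q n + r n)
    (hr : ∀ n, r n < (exponents b n).card)
    (h : NumericalCondition R₀ b H q r) {s : ℕ} (hs : (s : ℕ∞) = Module.length R₀ R₀) (n : ℕ) :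
    q n ≤ s ∧ (q n = s → r n = 0) := by
  induction n with
  | zero =>
    have h0 := h.1
    rw [← hs, Nat.cast_inj] at h0
    have h1 := hdiv 0
    have h2 := hr 0
    rw [card_exponents_zero] at h1 h2
    omega
  | succ n ih =>
    obtain ⟨h1, h2⟩ := h.quotient_antitone hb hdiv hr n
    refine ⟨by omega, fun e => ?_⟩
    have h3 := h2 (by omega)
    rw [ih.2 (by omega), plusPlus_zero] at h3
    omega

/-- The index of the term of the composition series which contains the coefficients at `X^u`. -/
noncomputable def idealLevel (s : ℕ) (q r : ℕ → ℕ) (u : Fin b →₀ ℕ) : ℕ :=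
  if u.degree = 0 then 0 else segmentLevel s (q u.degree) (r u.degree) u

theorem idealLevel_le (s : ℕ) (q r : ℕ → ℕ) (u : Fin b →₀ ℕ) : idealLevel s q r u ≤ s := by
  rw [idealLevel]
  split_ifs
  · exact Nat.zero_le _
  · exact (segmentLevel_le_sub _ _ _ _).trans (Nat.sub_le _ _)

/-- If q drops, the gain of a full layer absorbs the possible loss of one. If q is constant, a rank
of at least r(n) is sent to a rank of at least F_n(r(n)) ≥ r(n+1). -/
theorem NumericalCondition.idealLevel_le_add_single (hb : 1 ≤ b)
    (hdiv : ∀ n, H n = (exponents b n).card * q n + r n)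
    (hr : ∀ n, r n < (exponents b n).card)
    (h : NumericalCondition R₀ b H q r) {s : ℕ} (hs : (s : ℕ∞) = Module.length R₀ R₀)
    (u : Fin b →₀ ℕ) (j : Fin b) :
    idealLevel s q r u ≤ idealLevel s q r (u + Finsupp.single j 1) := by
  rw [idealLevel, idealLevel, degree_add_single, if_neg (Nat.succ_ne_zero _)]
  split_ifs with h0
  · exact Nat.zero_le _
  have hd : 1 ≤ u.degree := by omega
  have h1 := plusPlus_rank_le hd j
  obtain ⟨h2, h3⟩ := h.quotient_antitone hb hdiv hr u.degree
  have h4 := (h.quotient_le hb hdiv hr hs u.degree).1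
  have h5 := (plusPlus_strictMono hd).monotone (a := r u.degree) (b := rank u)
  rw [segmentLevel, segmentLevel]
  rcases h2.eq_or_lt with e | hlt
  · have h3 := h3 e
    rw [e]
    split_ifs with h6 h7
    · exact le_rfl
    · have := h5 h6
      omega
    · omega
    · exact le_rfl
  · split_ifs <;> omega

theorem existsUnique_segmentIdeal (hb : 1 ≤ b)
    (hdiv : ∀ n, H n = (exponents b n).card * q n + r n)
    (hr : ∀ n, r n < (exponents b n).card)
    (h : NumericalCondition R₀ b H q r) (J : CompositionSeries (Submodule R₀ R₀))
    (hJ : J.head = ⊥) (hJ' : J.last = ⊤) :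
    ∃! I : Ideal (MvPolynomial (Fin b) R₀),
      IsSegmentIdeal J I ∧ ∀ n, (H n : ℕ∞) = hilbertFunction I n := by
  have hs := Module.length_compositionSeries J hJ hJ'
  set s := J.length with hsdef
  have hlen : ∀ n, (exponents b n).card * q n + r n ≤ s * (exponents b n).card := fun n => by
    obtain ⟨h1, h2⟩ := h.quotient_le hb hdiv hr hs n
    rw [mul_comm s]
    rcases h1.eq_or_lt with e | hlt
    · rw [h2 e, e, add_zero]
    · have := Nat.mul_le_mul_left (exponents b n).card (show q n + 1 ≤ s by omega)
      have := hr n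
      rw [mul_add] at *
      omega
  let I : Ideal (MvPolynomial (Fin b) R₀) := coeffIdeal
    (fun u => seriesTerm J (idealLevel s q r u))
    (fun u j => seriesTerm_mono (h.idealLevel_le_add_single hb hdiv hr hs u j)
      (idealLevel_le s q r _))
  have hI : IsHomogeneousInIrrelevant I := by
    refine isHomogeneousInIrrelevant_coeffIdeal ?_
    rw [idealLevel, if_pos (map_zero _), seriesTerm_zero hJ]
  have hIlen : ∀ n, Module.length R₀ (gradedPart I n)
      = (∑ u ∈ exponents b n, idealLevel s q r u : ℕ) := fun n => by
    rw [length_gradedPart, Nat.cast_sum]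
    refine Finset.sum_congr rfl fun u _ => ?_
    rw [leadingCoeffs_coeffIdeal, length_seriesTerm hJ (idealLevel_le s q r u)]
  have hsum : ∀ n, ∑ u ∈ exponents b n, idealLevel s q r u + H n = s * (exponents b n).card := by
    intro n
    rcases Nat.eq_zero_or_pos n with rfl | hn
    · have h0 := h.1
      rw [← hs, Nat.cast_inj] at h0
      rw [Finset.sum_eq_zero fun u hu => by rw [idealLevel, if_pos (mem_exponents.1 hu)], h0,
        card_exponents_zero, zero_add, mul_one]
    · rw [hdiv, ← sum_segmentLevel (hr n) (hlen n)]
      congr 1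
      refine Finset.sum_congr rfl fun u hu => ?_
      rw [idealLevel, mem_exponents.1 hu, if_neg (by omega)]
  have hH : ∀ n, (H n : ℕ∞) = hilbertFunction I n := fun n => by
    have h1 := length_gradedPart_add_hilbertFunction I n
    rw [hIlen, ← hs, mul_comm, ← Nat.cast_mul, ← hsum n, Nat.cast_add] at h1
    exact (WithTop.add_left_cancel (ENat.natCast_ne_top _) h1).symm
  have hseg : ∀ n, 1 ≤ n → ∀ m, m + H n = s * (exponents b n).card →
      gradedPart I n = segmentPart b J n m := by
    intro n hn m hm
    rw [hdiv] at hm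
    apply le_antisymm
    · intro f hf
      rw [← support_sum_monomial_coeff f]
      refine Submodule.sum_mem _ fun u hu => ?_
      have hd : u.degree = n := by
        by_contra hd
        exact mem_support_iff.1 hu ((mem_gradedPart.1 hf).2.coeff_eq_zero hd)
      have hc : coeff u f ∈ seriesTerm J (idealLevel s q r u) := hf.1 u
      rcases Nat.eq_zero_or_pos (idealLevel s q r u) with h0 | h0
      · rw [h0, seriesTerm_zero hJ, Submodule.mem_bot] at hc
        exact absurd hc (mem_support_iff.1 hu)
      · refine Submodule.mem_iSup_of_mem (idealLevel s q r u, u)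
          (Submodule.mem_iSup_of_mem ?_ (Submodule.mem_map_of_mem hc))
        rw [← hsdef, mem_smallestIndices_iff (hr n) hm]
        refine ⟨h0, ?_, hd⟩
        rw [idealLevel, hd, if_neg (by omega)]
    · refine iSup₂_le fun p hp => ?_
      obtain ⟨i, u⟩ := p
      rw [← hsdef, mem_smallestIndices_iff (hr n) hm] at hp
      obtain ⟨-, h2, h3⟩ := hp
      rw [Submodule.map_le_iff_le_comap]
      intro x hx
      rw [Submodule.mem_comap, mem_gradedPart]
      refine ⟨monomial_mem_coeffIdeal (seriesTerm_mono ?_ (idealLevel_le s q r u) hx),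
        isHomogeneous_monomial x h3⟩
      rwa [idealLevel, h3, if_neg (by omega)]
  refine ⟨I, ⟨⟨hI, fun n hn => ?_⟩, hH⟩, ?_⟩
  · refine ⟨∑ u ∈ exponents b n, idealLevel s q r u, ?_, hseg n hn _ (hsum n)⟩
    rw [← hH, ← card_exponents hb, ← hsum n, Nat.cast_add]
  · rintro I' ⟨⟨hI', hseg'⟩, hH'⟩
    -- The Hilbert function determines how many submodules generate each component, and hence the
    -- component; a homogeneous ideal is determined by its components.
    have hgr : ∀ n, gradedPart I' n = gradedPart I n := fun n => by
      rcases Nat.eq_zero_or_pos n with rfl | hn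
      · rw [gradedPart_zero hI, gradedPart_zero hI']
      · obtain ⟨m, hm, hm'⟩ := hseg' n hn
        rw [← hH', ← card_exponents hb, ← Nat.cast_add, Nat.cast_inj] at hm
        rw [hm', hseg n hn m hm]
    ext f
    rw [mem_iff_homogeneousComponent_mem hI'.1, mem_iff_homogeneousComponent_mem hI.1]
    refine forall_congr' fun n => ?_
    have := SetLike.ext_iff.1 (hgr n) (homogeneousComponent n f)
    simpa only [mem_gradedPart, homogeneousComponent_isHomogeneous, and_true] using this

end Segment

end ArtinianHilbert

/-! ### The characterization theorem -/

theorem theorem2p8 {R₀ : Type*} [CommRing R₀] [IsLocalRing R₀] [IsArtinianRing R₀]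
    (hR₀ : ArtinianHilbert.IsEquicharacteristic R₀)
    (H : ℕ → ℕ) (b : ℕ) (hb : 1 ≤ b) (q r : ℕ → ℕ)
    (hdiv : ∀ n, H n = (n + b - 1).choose (b - 1) * q n + r n)
    (hr : ∀ n, r n < (n + b - 1).choose (b - 1)) :
    ((∃ I : Ideal (MvPolynomial (Fin b) R₀),
        ArtinianHilbert.IsHomogeneousInIrrelevant I ∧
          ∀ n, (H n : ℕ∞) = ArtinianHilbert.hilbertFunction I n) ↔
      ArtinianHilbert.NumericalCondition R₀ b H q r) ∧
    (ArtinianHilbert.NumericalCondition R₀ b H q r →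
      ∀ J : CompositionSeries (Submodule R₀ R₀), J.head = ⊥ → J.last = ⊤ →
        ∃! I : Ideal (MvPolynomial (Fin b) R₀),
          ArtinianHilbert.IsSegmentIdeal J I ∧
            ∀ n, (H n : ℕ∞) = ArtinianHilbert.hilbertFunction I n) := by
  have key : ArtinianHilbert.NumericalCondition R₀ b H q r →
      ∀ J : CompositionSeries (Submodule R₀ R₀), J.head = ⊥ → J.last = ⊤ →
        ∃! I : Ideal (MvPolynomial (Fin b) R₀),
          ArtinianHilbert.IsSegmentIdeal J I ∧
            ∀ n, (H n : ℕ∞) = ArtinianHilbert.hilbertFunction I n := fun h J hJ hJ' =>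
    ArtinianHilbert.existsUnique_segmentIdeal hb
      (fun n => by rw [ArtinianHilbert.card_exponents hb, hdiv])
      (fun n => by rw [ArtinianHilbert.card_exponents hb]; exact hr n) h J hJ hJ'
  refine ⟨⟨?_, fun h => ?_⟩, key⟩
  · rintro ⟨I, hI, hH⟩
    exact ArtinianHilbert.numericalCondition_of_ideal hb hdiv hr hI hH
  -- An Artinian ring has finite length over itself, so a composition series exists, and its segment
  -- ideal realizes H.
  · obtain ⟨J, hJ, hJ'⟩ := isFiniteLength_iff_exists_compositionSeries.1
      (Module.length_ne_top_iff.1 (Module.length_ne_top (R := R₀) (M := R₀)))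
    obtain ⟨I, ⟨hI, hH⟩, -⟩ := key h J hJ hJ'
    exact ⟨I, hI.1, hH⟩
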